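/- Let $S,A$ be finite nonempty sets and consider an MDP with initial state distribution $p$, transition probabilities $P(s'\mid s,a)$, reward function $r:S\times A\to[0,1]$ and discount factor $\gamma\in[0,1)$. For a policy $\pi(a\mid s)$ let $V^\pi(s)=(1-\gamma)\,\mathbb E\big[\sum_{t\ge 0}\gamma^t r(s_t,a_t)\mid s_0=s\big]$ and $V^\pi(p)=\mathbb E_{s\sim p}[V^\pi(s)]$. Let $\pi^*$ be an optimal policy (a maximizer of $V^\pi(p)$), $V^*(p)=V^{\pi^*}(p)$, and $\mu^*(s,a)=(1-\gamma)\sum_{t\ge0}\gamma^t\Pr_{\pi^*}(s_t=s)\,\pi^*(a\mid s)$ with $s_0\sim p$. The MDP is accessed only through a generative model, which on request returns a sample $s_0\sim p$, or, for a chosen pair $(s,a)$, the reward $r(s,a)$ together with a sample $s'\sim P(\cdot\mid s,a)$; each request counts as one sample. For $v\in\mathbb R^{S}$, $\mu\in\mathbb R^{S\times A}$ put $$a_v(s,a)=r(s,a)+\tfrac1{1-\gamma}\Big(\gamma\sum_{s'}P(s'\mid s,a)v(s')-v(s)\Big),\qquad L(v,\mu)=p^\top v+\mu^\top a_v,$$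 and for $x=(v,\mu)$, $x'=(v',\mu')$ put $F(x,x')=L(v',\mu)-L(v,\mu')$ and $r_{ep}(x;x')=F(x,x)-F(x,x')$. Let $d_v,d_\mu\ge1$, let $\Phi\in\mathbb R^{S\times d_v}$ have columns of sup-norm at most $1$ (in particular, columns in $[0,1]^S$ are allowed), let $\Psi\in\mathbb R^{(S\times A)\times d_\mu}$ have columns that are probability distributions on $S\times A$, let $C_v>0$, and let $$\Theta=\Big\{\theta=(\theta_v,\theta_\mu)\in\mathbb R^{d_v}\times\mathbb R^{d_\mu}:\ \|\theta_v\|_2\le \tfrac{C_v}{\sqrt{d_v}},\ \theta_\mu\ge0,\ \|\theta_\mu\|_1=1\Big\},\qquad \dim(\Theta):=d_v+d_\mu,$$ $x_\theta=(v_\theta,\mu_\theta)=(\Phi\theta_v,\Psi\theta_\mu)$. Mirror descent with $N\ge1$ rounds: start at $\theta_1\in\Theta$ with $\theta_{\mu,1}$ uniform and $\theta_{v,1}$ arbitrary. For $n=1,\dots,N-1$: draw $s_0\sim p$, $(s,a)\sim\Psi\theta_{\mu,n}$, $s'\sim P(\cdot\mid s,a)$; independently draw an index $k$ uniformly from $\{1,\dots,d_\mu\}$,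 a pair $(\hat s,\hat a)$ from the $k$-th column of $\Psi$, and query its reward and a next state $\hat s'\sim P(\cdot\mid\hat s,\hat a)$; let $g_n=(g_{n,v},g_{n,\mu})$ with $$g_{n,v}=\Phi(s_0,\cdot)+\tfrac{1}{1-\gamma}\big(\gamma\Phi(s',\cdot)-\Phi(s,\cdot)\big),\qquad g_{n,\mu}=d_\mu\Big(\tfrac1{1-\gamma}-r(\hat s,\hat a)-\tfrac{\gamma v_{\theta_n}(\hat s')-v_{\theta_n}(\hat s)}{1-\gamma}\Big)e_k,$$ and update $$\theta_{n+1}=\operatorname*{argmin}_{\theta\in\Theta}\ \langle g_n,\theta\rangle+\tfrac1\eta\Big(\tfrac{d_v}{2C_v^2}\|\theta_v-\theta_{v,n}\|_2^2+\mathrm{KL}(\theta_\mu\|\theta_{\mu,n})\Big),\qquad \eta=\frac{1-\gamma}{\sqrt{N(C_v^2+d_\mu)}} .$$ Output $\hat x_N=(\hat v_N,\hat\mu_N)=\frac1N\sum_{n=1}^N x_{\theta_n}$ and a policy $\hat\pi_N(a\mid s)\propto\hat\mu_N(s,a)$ (arbitrary at states of zero $\hat\mu_N$-mass). The approximation error is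 $$\epsilon_{\Theta,N}=\min_{\theta\in\Theta}\Big(r_{ep}\big(\hat x_N;(V^{\hat\pi_N},\mu^*)\big)-r_{ep}(\hat x_N;x_\theta)\Big).$$ Theorem. For every $C_v>0$ there is a constant $C>0$, depending only on $C_v$, such that for all $d_v,d_\mu\ge1$, $\gamma\in[0,1)$, $\epsilon>0$ and $\delta\in(0,1)$ there is a number of rounds $N_0\ge1$, the same for all finite nonempty $S,A$, all such $\Phi,\Psi$, all such $\theta_1$ and all MDPs on $S,A$, for which the following holds. With $N_0$ rounds the algorithm always uses at most $$C\,\frac{\dim(\Theta)\,(1+\log\dim(\Theta))^2\,\log(2/\delta)}{(1-\gamma)^2\epsilon^2}$$ samples, that is, $\tilde O\big(\frac{\dim(\Theta)\log(1/\delta)}{(1-\gamma)^2\epsilon^2}\big)$, independent of $|S|$ and $|A|$; and for every $N\ge N_0$ and every optimal policy $\pi^*$, with probability at least $1-\delta$ the output policy is $(\epsilon+\epsilon_{\Theta,N})$-optimal, i.e. $V^*(p)-V^{\hat\pi_N}(p)\le\epsilon+\epsilon_{\Theta,N}$ (for every choice of $\hat\pi_N$ at states of zero $\hat\mu_N$-mass).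 -/

import Mathlib

universe u v w

noncomputable section

namespace MirrorRL

/-! ### Discounted Markov decision processes -/

/-- A finite Markov decision process without its discount factor: initial state distribution `p`,
transition probabilities `P(· | s, a)` and reward function `r : S × A → [0, 1]`. -/
structure MDP (S : Type u) (A : Type v) where
  init : PMF S
  trans : S → A → PMF S
  reward : S → A → ℝ
  reward_mem : ∀ s a, reward s a ∈ Set.Icc (0 : ℝ) 1

/-- A (stationary, randomized) policy `π(a | s)`. -/
abbrev Policy (S : Type u) (A : Type v) := S → PMF A

/-- A pair `x = (v, μ)` of a function on states and a function on state-action pairs. -/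
abbrev Decision (S : Type u) (A : Type v) := (S → ℝ) × (S × A → ℝ)

namespace MDP

variable {S : Type u} {A : Type v}

/-- The law of the state at time `t` when `π` is run and the state at time `0` has law `ν`. -/
def stateLaw (M : MDP S A) (π : Policy S A) (ν : PMF S) : ℕ → PMF S
  | 0 => ν
  | t + 1 => (stateLaw M π ν t).bind fun s => (π s).bind fun a => M.trans s a

variable [Fintype S] [Fintype A]

/-- The expected reward `E[r(s_t, a_t)]` at time `t` along the trajectory of `π` started at `s`. -/
def expReward (M : MDP S A) (π : Policy S A) (s : S) (t : ℕ) : ℝ :=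
  ∑ s', (M.stateLaw π (PMF.pure s) t s').toReal * ∑ a, (π s' a).toReal * M.reward s' a

/-- The normalized value function `V^π(s) = (1 - γ) E[∑_t γ^t r(s_t, a_t) | s_0 = s]`. -/
def value (M : MDP S A) (γ : ℝ) (π : Policy S A) (s : S) : ℝ :=
  (1 - γ) * ∑' t : ℕ, γ ^ t * M.expReward π s t

/-- The return `V^π(p) = E_{s ∼ p} V^π(s)`. -/
def ret (M : MDP S A) (γ : ℝ) (π : Policy S A) : ℝ :=
  ∑ s, (M.init s).toReal * M.value γ π s

/-- `π` is an optimal policy: it maximizes the return. -/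
def IsOptimal (M : MDP S A) (γ : ℝ) (π : Policy S A) : Prop :=
  ∀ π' : Policy S A, M.ret γ π' ≤ M.ret γ π

/-- The average state distribution `d^π = (1 - γ) ∑_t γ^t d_t^π`, started from `p`. -/
def avgState (M : MDP S A) (γ : ℝ) (π : Policy S A) (s : S) : ℝ :=
  (1 - γ) * ∑' t : ℕ, γ ^ t * (M.stateLaw π M.init t s).toReal

/-- The average state-action distribution `μ^π(s, a) = d^π(s) π(a | s)`. -/
def occupancy (M : MDP S A) (γ : ℝ) (π : Policy S A) (z : S × A) : ℝ :=
  M.avgState γ π z.1 * (π z.1 z.2).toReal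

/-- The advantage function `a_v = r + (γ P - E) v / (1 - γ)`. -/
def advantage (M : MDP S A) (γ : ℝ) (v : S → ℝ) (z : S × A) : ℝ :=
  M.reward z.1 z.2 + (γ * ∑ s', (M.trans z.1 z.2 s').toReal * v s' - v z.1) / (1 - γ)

/-- The Lagrangian `L(v, μ) = pᵀ v + μᵀ a_v`. -/
def lagrangian (M : MDP S A) (γ : ℝ) (v : S → ℝ) (μ : S × A → ℝ) : ℝ :=
  ∑ s, (M.init s).toReal * v s + ∑ z, μ z * M.advantage γ v z

/-- The bifunction `F(x, x') = L(v', μ) - L(v, μ')` of the saddle-point problem. -/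
def bifun (M : MDP S A) (γ : ℝ) (x x' : Decision S A) : ℝ :=
  M.lagrangian γ x'.1 x.2 - M.lagrangian γ x.1 x'.2

/-- The relative residual `r_ep(x; x') = F(x, x) - F(x, x')`. -/
def residual (M : MDP S A) (γ : ℝ) (x x' : Decision S A) : ℝ :=
  M.bifun γ x x - M.bifun γ x x'

end MDP

/-- `π(a | s) ∝ μ(s, a)`; nothing is asked of `π(· | s)` at states `s` that `μ` does not charge. -/
def IsInducedBy {S : Type u} {A : Type v} [Fintype A] (π : Policy S A) (μ : S × A → ℝ) : Prop :=
  ∀ s a, (π s a).toReal * ∑ b, μ (s, b) = μ (s, a)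

/-! ### Linear function approximators -/

/-- The parameter set `Θ`: pairs `(θ_v, θ_μ)` with `‖θ_v‖₂ ≤ C_v / √dim θ_v`, and `θ_μ` in the
probability simplex. -/
def paramSet (dv dμ : ℕ) (Cv : ℝ) : Set (EuclideanSpace ℝ (Fin dv) × (Fin dμ → ℝ)) :=
  {θ | ‖θ.1‖ ≤ Cv / Real.sqrt dv ∧ θ.2 ∈ stdSimplex ℝ (Fin dμ)}

/-- Basis functions: `Φ s i` is the value at `s` of the `i`-th column of `Φ`, and `Ψ k` is the
`k`-th column of `Ψ`, a distribution over state-action pairs. -/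
structure Basis (S : Type u) (A : Type v) (dv dμ : ℕ) where
  Φ : S → Fin dv → ℝ
  Ψ : Fin dμ → PMF (S × A)
  Φ_le : ∀ s i, |Φ s i| ≤ 1

variable {S : Type u} {A : Type v} {dv dμ : ℕ} {Cv : ℝ}

/-- `x_θ = (Φ θ_v, Ψ θ_μ)`. -/
def Basis.decode (B : Basis S A dv dμ) (θ : paramSet dv dμ Cv) : Decision S A :=
  (fun s => ∑ i, B.Φ s i * θ.1.1 i, fun z => ∑ k, (B.Ψ k z).toReal * θ.1.2 k)

/-- `θ_μ`, viewed as a distribution over the columns of `Ψ`. -/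
def weights (θ : paramSet dv dμ Cv) : PMF (Fin dμ) :=
  PMF.ofFintype (fun k => ENNReal.ofReal (θ.1.2 k)) (by
    rw [← ENNReal.ofReal_sum_of_nonneg fun k _ => θ.2.2.1 k, θ.2.2.2, ENNReal.ofReal_one])

/-- The distribution `Ψ θ_μ` over state-action pairs, for drawing samples. -/
def Basis.mixture (B : Basis S A dv dμ) (θ : paramSet dv dμ Cv) : PMF (S × A) :=
  (weights θ).bind B.Ψ

/-- The approximation error
`ε_{Θ,N} = min_{θ ∈ Θ} r_ep(x̂; y) - r_ep(x̂; x_θ)` with `y = (v^π̂, μ^π⋆)`. -/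
def approxError [Fintype S] [Fintype A] (M : MDP S A) (γ : ℝ) (B : Basis S A dv dμ) (Cv : ℝ)
    (πstar πhat : Policy S A) (xhat : Decision S A) : ℝ :=
  ⨅ θ : paramSet dv dμ Cv,
    (M.residual γ xhat (M.value γ πhat, M.occupancy γ πstar) - M.residual γ xhat (B.decode θ))

/-! ### Randomized programs with access to a generative model -/

/-- Randomized programs that can access an MDP only through its generative model: by drawing an
initial state (`sampleInit`), or by querying a state-action pair, which returns its reward and a
sampled next state (`query`). The draws `drawPair` and `drawIndex` are the program's own
randomness. -/
inductive Prog (S : Type u) (A : Type v) (α : Type w) : Type (max u v w)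
  | done (x : α) : Prog S A α
  | sampleInit (k : S → Prog S A α) : Prog S A α
  | query (s : S) (a : A) (k : ℝ → S → Prog S A α) : Prog S A α
  | drawPair (q : PMF (S × A)) (k : S → A → Prog S A α) : Prog S A α
  | drawIndex {m : ℕ} (q : PMF (Fin m)) (k : Fin m → Prog S A α) : Prog S A α

/-- Apply a function to the result of a program. -/
def Prog.map {α : Type w} {β : Type*} (f : α → β) : Prog S A α → Prog S A β
  | .done x => .done (f x)
  | .sampleInit k => .sampleInit fun s => (k s).map f
  | .query s a k => .query s a fun r s' => (k r s').map f
  | .drawPair q k => .drawPair q fun s a => (k s a).map f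
  | .drawIndex q k => .drawIndex q fun i => (k i).map f

/-- The joint law of the result of a program on `M` and of the number of samples that it has
requested from the generative model of `M`. -/
def Prog.run {α : Type w} (M : MDP S A) : Prog S A α → PMF (α × ℕ)
  | .done x => PMF.pure (x, 0)
  | .sampleInit k => M.init.bind fun s =>
      ((k s).run M).map fun o => (o.1, o.2 + 1)
  | .query s a k => (M.trans s a).bind fun s' =>
      ((k (M.reward s a) s').run M).map fun o => (o.1, o.2 + 1)
  | .drawPair q k => q.bind fun z => (k z.1 z.2).run M
  | .drawIndex q k => q.bind fun i => (k i).run M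

/-! ### Mirror descent -/

/-- The Bregman divergence
`B_R(θ' ‖ θ) = dim(θ_v) / (2 C_v²) ‖θ'_v - θ_v‖₂² + KL(θ'_μ ‖ θ_μ)`.
(It is used only for `θ_μ > 0`; the convention `0 log 0 = 0` holds.) -/
def bregman (θ' θ : paramSet dv dμ Cv) : ℝ :=
  dv / (2 * Cv ^ 2) * ‖θ'.1.1 - θ.1.1‖ ^ 2 + ∑ k, θ'.1.2 k * Real.log (θ'.1.2 k / θ.1.2 k)

/-- The objective `⟨g, θ'⟩ + B_R(θ' ‖ θ) / η` of a mirror descent step at `θ`. -/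
def stepObjective (η : ℝ) (g : (Fin dv → ℝ) × (Fin dμ → ℝ)) (θ θ' : paramSet dv dμ Cv) : ℝ :=
  (∑ i, g.1 i * θ'.1.1 i + ∑ k, g.2 k * θ'.1.2 k) + 1 / η * bregman θ' θ

/-- The mirror descent update `argmin_{θ' ∈ Θ} ⟨g, θ'⟩ + B_R(θ' ‖ θ) / η`. -/
def mdUpdate (η : ℝ) (g : (Fin dv → ℝ) × (Fin dμ → ℝ)) (θ : paramSet dv dμ Cv) :
    paramSet dv dμ Cv :=
  @Classical.epsilon _ ⟨θ⟩ fun θ' => ∀ ϑ, stepObjective η g θ θ' ≤ stepObjective η g θ ϑ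

/-- The `v`-part of the sampled gradient, from an initial state `s₀`, a state-action pair at state
`s` drawn from `Ψ θ_μ`, and the next state `s'`. -/
def gradV (γ : ℝ) (B : Basis S A dv dμ) (s₀ s s' : S) (i : Fin dv) : ℝ :=
  B.Φ s₀ i + (γ * B.Φ s' i - B.Φ s i) / (1 - γ)

/-- The `μ`-part of the sampled gradient, from a uniform column index `k`, a state-action pair at
state `s` drawn from that column, its reward `r` and the next state `s'`. -/
def gradMu (γ : ℝ) (B : Basis S A dv dμ) (θ : paramSet dv dμ Cv) (k : Fin dμ) (s : S) (r : ℝ)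
    (s' : S) (j : Fin dμ) : ℝ :=
  if j = k then
    dμ * (1 / (1 - γ) - r - (γ * (B.decode θ).1 s' - (B.decode θ).1 s) / (1 - γ))
  else 0

/-- Mirror descent with step size `η`, started at `θ`, for `n` updates; the result is the list of
the `n + 1` iterates. -/
def mdLoop [NeZero dμ] (γ η : ℝ) (B : Basis S A dv dμ) :
    ℕ → paramSet dv dμ Cv → Prog S A (List (paramSet dv dμ Cv))
  | 0, θ => .done [θ]
  | n + 1, θ =>
    .sampleInit fun s₀ =>
    .drawPair (B.mixture θ) fun s₁ a₁ =>
    .query s₁ a₁ fun _ s₁' =>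
    .drawIndex (PMF.uniformOfFintype (Fin dμ)) fun k =>
    .drawPair (B.Ψ k) fun s₂ a₂ =>
    .query s₂ a₂ fun r₂ s₂' =>
    (mdLoop γ η B n
      (mdUpdate η (gradV γ B s₀ s₁ s₁', gradMu γ B θ k s₂ r₂ s₂') θ)).map (θ :: ·)

/-- The average `x̂ = (1/N) ∑_n x_{θ_n}` of the decisions given by a list of iterates. -/
def Basis.average (B : Basis S A dv dμ) (l : List (paramSet dv dμ Cv)) : Decision S A :=
  (l.length : ℝ)⁻¹ • (l.map B.decode).sum

/-- Mirror descent for RL with basis functions: `N` iterates `θ_1, …, θ_N` from `N - 1` updates with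
step size `η = (1 - γ) / √(N (C_v² + dim θ_μ))`; the result is the average decision `x̂_N`. -/
def mdForRL [NeZero dμ] (γ : ℝ) (B : Basis S A dv dμ) (N : ℕ) (θ₁ : paramSet dv dμ Cv) :
    Prog S A (Decision S A) :=
  (mdLoop γ ((1 - γ) / Real.sqrt (N * (Cv ^ 2 + dμ))) B (N - 1) θ₁).map B.average

end MirrorRL

end

/-!
The residual of `x̂ = (v̂, μ̂)` at `(V^π̂, μ^*)`, where `π̂` is induced by `μ̂`, is exactly the
regret `V^*(p) - V^π̂(p)`: the Lagrangian equals the return of a policy as soon as `μ` is its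
occupancy measure, and also as soon as `v` is its value function and `μ` induces it. After
subtracting the approximation error it therefore suffices to bound the residual of the average
iterate against every comparator in `Θ` at once.

Since `F(x, x) = 0`, the residual is affine in its first argument. Thus `N` times the residual of
the average is the sum of the residuals of the iterates, and each of these is the conditional
expectation of the linearized regret `⟨g_n, θ_n - ϑ⟩`. Mirror descent bounds the sum of the
linearized regrets by `(log dim(θ_μ) + ∑ local norms) / η`. The noise is uniform in `ϑ` because `ϑ`
enters linearly, through finitely many entries of the gradients, each of which obeys a Bernstein
bound. A gradient entry is of size `dim(θ_μ)` but only with probability `1 / dim(θ_μ)`, so variances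
and expected local norms are of order `dim(θ_μ)` rather than its square, which is what makes the
sample complexity linear in `dim(Θ)`.
-/

noncomputable section

namespace MirrorRL

/-! ### Expectations over finite types -/

section Expect

variable {α β : Type*} [Fintype α] (p : PMF α)

/-- The expectation of a real function under a distribution on a finite type, as a finite sum. -/
def expect (f : α → ℝ) : ℝ := ∑ a, (p a).toReal * f a

theorem sum_toReal_eq_one : ∑ a, (p a).toReal = 1 := by
  rw [← ENNReal.toReal_sum fun a _ => p.apply_ne_top a, ← tsum_fintype (L := .unconditional _),
    p.tsum_coe, ENNReal.toReal_one]

@[simp]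
theorem expect_const (c : ℝ) : expect p (fun _ => c) = c := by
  rw [expect, ← Finset.sum_mul, sum_toReal_eq_one, one_mul]

@[simp]
theorem expect_pure (a : α) (f : α → ℝ) : expect (PMF.pure a) f = f a := by
  classical
  rw [expect, Finset.sum_eq_single a]
  · simp
  · intro b _ hb
    simp [PMF.pure_apply, hb]
  · simp

theorem toReal_bind_apply (q : α → PMF β) (b : β) :
    (p.bind q b).toReal = expect p fun a => (q a b).toReal := by
  rw [PMF.bind_apply, tsum_fintype, ENNReal.toReal_sum]
  · simp [expect]
  · exact fun a _ => ENNReal.mul_ne_top (p.apply_ne_top a) ((q a).apply_ne_top b)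

@[simp]
theorem expect_bind [Fintype β] (q : α → PMF β) (f : β → ℝ) :
    expect (p.bind q) f = expect p fun a => expect (q a) f := by
  simp only [expect, toReal_bind_apply, Finset.sum_mul, Finset.mul_sum]
  rw [Finset.sum_comm]
  simp only [mul_assoc]

theorem expect_add (f g : α → ℝ) :
    expect p (fun a => f a + g a) = expect p f + expect p g := by
  simp [expect, mul_add, Finset.sum_add_distrib]

theorem expect_sub (f g : α → ℝ) :
    expect p (fun a => f a - g a) = expect p f - expect p g := by
  simp [expect, mul_sub, Finset.sum_sub_distrib]

theorem expect_const_mul (c : ℝ) (f : α → ℝ) :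
    expect p (fun a => c * f a) = c * expect p f := by
  simp only [expect, Finset.mul_sum, mul_left_comm]

theorem expect_mul_const (c : ℝ) (f : α → ℝ) :
    expect p (fun a => f a * c) = expect p f * c := by
  simp only [mul_comm _ c, expect_const_mul]

theorem expect_div_const (c : ℝ) (f : α → ℝ) :
    expect p (fun a => f a / c) = expect p f / c := by
  simp only [div_eq_mul_inv, expect_mul_const]

theorem expect_mono {f g : α → ℝ} (h : ∀ a, f a ≤ g a) : expect p f ≤ expect p g :=
  Finset.sum_le_sum fun a _ => mul_le_mul_of_nonneg_left (h a) ENNReal.toReal_nonneg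

theorem expect_le {f : α → ℝ} {c : ℝ} (h : ∀ a, f a ≤ c) : expect p f ≤ c :=
  (expect_mono p h).trans_eq (expect_const p c)

theorem le_expect {f : α → ℝ} {c : ℝ} (h : ∀ a, c ≤ f a) : c ≤ expect p f :=
  (expect_const p c).symm.trans_le (expect_mono p h)

theorem abs_expect_le {f : α → ℝ} {c : ℝ} (h : ∀ a, |f a| ≤ c) : |expect p f| ≤ c :=
  abs_le.2 ⟨le_expect p fun a => (abs_le.1 (h a)).1, expect_le p fun a => (abs_le.1 (h a)).2⟩

theorem expect_tsum {f : α → ℕ → ℝ} (hf : ∀ a, Summable (f a)) :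
    (expect p fun a => ∑' t, f a t) = ∑' t, expect p fun a => f a t := by
  simp only [expect, ← tsum_mul_left]
  exact (Summable.tsum_finsetSum fun a _ => (hf a).mul_left _).symm

theorem tsum_mul_ofReal {f : α → ℝ} (hf : ∀ a, 0 ≤ f a) :
    ∑' a, p a * ENNReal.ofReal (f a) = ENNReal.ofReal (expect p f) := by
  rw [tsum_fintype, expect, ENNReal.ofReal_sum_of_nonneg
    fun a _ => mul_nonneg ENNReal.toReal_nonneg (hf a)]
  refine Finset.sum_congr rfl fun a _ => ?_
  rw [ENNReal.ofReal_mul ENNReal.toReal_nonneg, ENNReal.ofReal_toReal (p.apply_ne_top a)]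

theorem exp_le_one_add_add_sq {x : ℝ} (hx : |x| ≤ 1) : Real.exp x ≤ 1 + x + x ^ 2 := by
  linarith [(abs_le.1 (Real.abs_exp_sub_one_sub_id_le hx)).2]

theorem expect_exp_mul_sub_le {X : α → ℝ} {c V : ℝ} (hX : ∀ a, |c * X a| ≤ 1)
    (hV : expect p (fun a => X a ^ 2) ≤ V) :
    expect p (fun a => Real.exp (c * (X a - expect p X))) ≤ Real.exp (c ^ 2 * V) := by
  set m := expect p X with hm
  have exp_le : ∀ a, Real.exp (c * (X a - m)) ≤
      Real.exp (-(c * m)) * (1 + c * X a + c ^ 2 * X a ^ 2) := fun a => by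
    rw [mul_sub, sub_eq_neg_add, Real.exp_add, ← mul_pow]
    exact mul_le_mul_of_nonneg_left (exp_le_one_add_add_sq (hX a)) (Real.exp_pos _).le
  refine (expect_mono p exp_le).trans ?_
  rw [expect_const_mul, expect_add, expect_add, expect_const, expect_const_mul, expect_const_mul,
    ← hm, Real.exp_neg, inv_mul_le_iff₀ (Real.exp_pos _), ← Real.exp_add]
  calc 1 + c * m + c ^ 2 * expect p (fun a => X a ^ 2) ≤ c * m + c ^ 2 * V + 1 := by
        linarith [mul_le_mul_of_nonneg_left hV (sq_nonneg c)]
    _ ≤ Real.exp (c * m + c ^ 2 * V) := Real.add_one_le_exp _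

end Expect

/-! ### Adaptively drawn sequences -/

section AdaptiveDraws

theorem tsum_bind_mul {α β : Type*} (p : PMF α) (f : α → PMF β) (φ : β → ENNReal) :
    ∑' b, p.bind f b * φ b = ∑' a, p a * ∑' b, f a b * φ b := by
  simp only [PMF.bind_apply, ← ENNReal.tsum_mul_right, ← ENNReal.tsum_mul_left]
  rw [ENNReal.tsum_comm]
  simp only [mul_assoc]

theorem tsum_map_mul {α β : Type*} (p : PMF α) (f : α → β) (φ : β → ENNReal) :
    ∑' b, p.map f b * φ b = ∑' a, p a * φ (f a) := by
  rw [PMF.map, tsum_bind_mul]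
  simp

theorem toOuterMeasure_le_tsum {α : Type*} (p : PMF α) (s : Set α) (φ : α → ENNReal)
    (h : ∀ a ∈ s, 1 ≤ φ a) : p.toOuterMeasure s ≤ ∑' a, p a * φ a := by
  classical
  rw [PMF.toOuterMeasure_apply]
  refine ENNReal.tsum_le_tsum fun a => ?_
  by_cases ha : a ∈ s
  · simpa [ha] using mul_le_mul_right (h a ha) (p a)
  · simp [ha]

variable {Θ Ω : Type*} (q : Θ → PMF Ω) (upd : Θ → Ω → Θ)

/-- The law of the first `n` draws of a controlled process started at `θ`: at the state `θ` a draw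
`ω` has law `q θ` and moves the process to the state `upd θ ω`. -/
def drawsLaw : ℕ → Θ → PMF (List Ω)
  | 0, _ => PMF.pure []
  | n + 1, θ => (q θ).bind fun ω => (drawsLaw n (upd θ ω)).map (ω :: ·)

/-- The states at which the draws of a controlled process are made, paired with these draws. -/
def steps : Θ → List Ω → List (Θ × Ω)
  | _, [] => []
  | θ, ω :: l => (θ, ω) :: steps (upd θ ω) l

/-- The state of a controlled process after its last draw. -/
def lastState : Θ → List Ω → Θ
  | θ, [] => θ
  | θ, ω :: l => lastState (upd θ ω) l

/-- All states visited by a controlled process, one more than there are draws. -/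
def iterates : Θ → List Ω → List Θ
  | θ, [] => [θ]
  | θ, ω :: l => θ :: iterates (upd θ ω) l

theorem iterates_eq (θ : Θ) (l : List Ω) :
    iterates upd θ l = (steps upd θ l).map Prod.fst ++ [lastState upd θ l] := by
  induction l generalizing θ with
  | nil => rfl
  | cons ω l ih => simp [iterates, steps, lastState, ih]

@[simp]
theorem length_steps (θ : Θ) (l : List Ω) : (steps upd θ l).length = l.length := by
  induction l generalizing θ with
  | nil => rfl
  | cons ω l ih => simp [steps, ih]

@[simp]
theorem length_iterates (θ : Θ) (l : List Ω) : (iterates upd θ l).length = l.length + 1 := by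
  simp [iterates_eq]

theorem length_of_mem_support_drawsLaw {n : ℕ} {θ : Θ} {l : List Ω}
    (h : l ∈ (drawsLaw q upd n θ).support) : l.length = n := by
  induction n generalizing θ l with
  | zero => simp_all [drawsLaw]
  | succ n ih =>
    simp only [drawsLaw, PMF.mem_support_bind_iff, PMF.mem_support_map_iff] at h
    obtain ⟨ω, -, l', hl', rfl⟩ := h
    simp [ih hl']

variable [Fintype Ω]

theorem tsum_drawsLaw_exp_le {f : Θ × Ω → ℝ} {K : ℝ}
    (hf : ∀ θ, expect (q θ) (fun ω => Real.exp (f (θ, ω))) ≤ K) (n : ℕ) (θ : Θ) :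
    ∑' l, drawsLaw q upd n θ l * ENNReal.ofReal (Real.exp ((steps upd θ l).map f).sum) ≤
      ENNReal.ofReal K ^ n := by
  induction n generalizing θ with
  | zero => simp [drawsLaw, steps]
  | succ n ih =>
    rw [drawsLaw, tsum_bind_mul]
    simp only [tsum_map_mul, steps, List.map_cons, List.sum_cons, Real.exp_add]
    calc _ = ∑' ω, q θ ω * (ENNReal.ofReal (Real.exp (f (θ, ω))) *
          ∑' l, drawsLaw q upd n (upd θ ω) l *
            ENNReal.ofReal (Real.exp ((steps upd (upd θ ω) l).map f).sum)) := by
          simp only [ENNReal.ofReal_mul (Real.exp_pos _).le, mul_left_comm (drawsLaw _ _ _ _ _),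
            ENNReal.tsum_mul_left]
      _ ≤ ∑' ω, q θ ω * (ENNReal.ofReal (Real.exp (f (θ, ω))) * ENNReal.ofReal K ^ n) :=
          ENNReal.tsum_le_tsum fun ω => by gcongr; exact ih _
      _ ≤ ENNReal.ofReal K * ENNReal.ofReal K ^ n := by
          simp only [← mul_assoc, ENNReal.tsum_mul_right]
          rw [tsum_mul_ofReal _ fun ω => (Real.exp_pos _).le]
          gcongr
          exact hf θ
      _ = ENNReal.ofReal K ^ (n + 1) := (pow_succ' _ _).symm

/-- The sum of the values of `X` along a list of steps of a controlled process, each centered at its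
conditional expectation given the state: a martingale in the number of draws. -/
def deviation (L : List (Θ × Ω)) : (Θ × Ω → ℝ) →ₗ[ℝ] ℝ where
  toFun X := (L.map fun z => X z - expect (q z.1) fun ω => X (z.1, ω)).sum
  map_add' X Y := by
    rw [← List.sum_map_add]
    congr 2
    funext z
    simp only [Pi.add_apply, expect_add]
    ring
  map_smul' c X := by
    rw [RingHom.id_apply, smul_eq_mul, ← List.sum_map_mul_left]
    congr 2
    funext z
    simp only [Pi.smul_apply, smul_eq_mul, expect_const_mul]
    ring

theorem deviation_eq_sub (L : List (Θ × Ω)) (X : Θ × Ω → ℝ) :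
    deviation q L X = (L.map X).sum - (L.map fun z => expect (q z.1) fun ω => X (z.1, ω)).sum := by
  rw [eq_sub_iff_add_eq, deviation, LinearMap.coe_mk, AddHom.coe_mk, ← List.sum_map_add]
  simp only [sub_add_cancel]

theorem drawsLaw_deviation_gt_le_exp {X : Θ × Ω → ℝ} {c V : ℝ} (hc : 0 ≤ c)
    (hX : ∀ z, c * |X z| ≤ 1) (hV : ∀ θ, expect (q θ) (fun ω => X (θ, ω) ^ 2) ≤ V) (t : ℝ)
    (n : ℕ) (θ : Θ) :
    (drawsLaw q upd n θ).toOuterMeasure {l | t < deviation q (steps upd θ l) X} ≤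
      ENNReal.ofReal (Real.exp (n * (c ^ 2 * V) - c * t)) := by
  have moment := tsum_drawsLaw_exp_le q upd (θ := θ) (n := n)
    (f := fun z => c * (X z - expect (q z.1) fun ω => X (z.1, ω)))
    fun θ => expect_exp_mul_sub_le (q θ)
      (fun ω => by rw [abs_mul, abs_of_nonneg hc]; exact hX (θ, ω)) (hV θ)
  simp only [List.sum_map_mul_left] at moment
  calc _ ≤ ∑' l, drawsLaw q upd n θ l * (ENNReal.ofReal (Real.exp (-(c * t))) *
        ENNReal.ofReal (Real.exp (c * deviation q (steps upd θ l) X))) := by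
        refine toOuterMeasure_le_tsum _ _ _ fun l hl => ?_
        rw [← ENNReal.ofReal_mul (Real.exp_pos _).le, ← Real.exp_add, ENNReal.one_le_ofReal,
          Real.one_le_exp_iff]
        linarith [mul_le_mul_of_nonneg_left (le_of_lt (Set.mem_ofPred.1 hl)) hc]
    _ ≤ ENNReal.ofReal (Real.exp (-(c * t))) * ENNReal.ofReal (Real.exp (c ^ 2 * V)) ^ n := by
        simp only [mul_left_comm (drawsLaw _ _ _ _ _), ENNReal.tsum_mul_left]
        gcongr
        exact moment
    _ = ENNReal.ofReal (Real.exp (n * (c ^ 2 * V) - c * t)) := by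
        rw [← ENNReal.ofReal_pow (Real.exp_pos _).le, ← Real.exp_nat_mul,
          ← ENNReal.ofReal_mul (Real.exp_pos _).le, ← Real.exp_add, neg_add_eq_sub]

theorem drawsLaw_deviation_gt_le {X : Θ × Ω → ℝ} {b V Λ N : ℝ} (hX : ∀ z, |X z| ≤ b)
    (hV : ∀ θ, expect (q θ) (fun ω => X (θ, ω) ^ 2) ≤ V) (hVpos : 0 < V) (hΛ : 0 ≤ Λ)
    (hN : 0 < N) (hbN : b ^ 2 * Λ ≤ N * V) {n : ℕ} (hn : n ≤ N) (θ : Θ) :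
    (drawsLaw q upd n θ).toOuterMeasure
        {l | 2 * Real.sqrt (N * V * Λ) < deviation q (steps upd θ l) X} ≤
      ENNReal.ofReal (Real.exp (-Λ)) := by
  have hNV : 0 < N * V := mul_pos hN hVpos
  set c := Real.sqrt (Λ / (N * V)) with hc
  have c_sq : c ^ 2 * (N * V) = Λ := by
    rw [hc, Real.sq_sqrt (by positivity), div_mul_cancel₀ _ hNV.ne']
  have c_mul_sqrt : c * Real.sqrt (N * V * Λ) = Λ := by
    rw [hc, ← Real.sqrt_mul (by positivity), div_mul_eq_mul_div, mul_left_comm,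
      mul_div_cancel_left₀ _ hNV.ne', Real.sqrt_mul_self hΛ]
  have c_mul_le : ∀ z, c * |X z| ≤ 1 := fun z => by
    refine (sq_le_one_iff₀ (by positivity)).1 ?_
    rw [mul_pow, hc, Real.sq_sqrt (by positivity), div_mul_eq_mul_div, div_le_one hNV]
    refine le_trans ?_ hbN
    rw [mul_comm]
    gcongr
    exact hX z
  refine (drawsLaw_deviation_gt_le_exp q upd (Real.sqrt_nonneg _) c_mul_le hV _ n θ).trans ?_
  gcongr
  have := mul_le_mul_of_nonneg_right hn (by positivity : 0 ≤ c ^ 2 * V)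
  linarith

theorem drawsLaw_exists_deviation_gt_le {ι : Type*} [Fintype ι] {X : ι → Θ × Ω → ℝ} {b V Λ N : ℝ}
    (hX : ∀ j z, |X j z| ≤ b) (hV : ∀ j θ, expect (q θ) (fun ω => X j (θ, ω) ^ 2) ≤ V)
    (hVpos : 0 < V) (hΛ : 0 ≤ Λ) (hN : 0 < N) (hbN : b ^ 2 * Λ ≤ N * V) {n : ℕ} (hn : n ≤ N)
    (θ : Θ) :
    (drawsLaw q upd n θ).toOuterMeasure
        {l | ∃ j, 2 * Real.sqrt (N * V * Λ) < deviation q (steps upd θ l) (X j)} ≤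
      ENNReal.ofReal (Fintype.card ι * Real.exp (-Λ)) := by
  rw [Set.ofPred_exists]
  refine (MeasureTheory.measure_iUnion_fintype_le _ _).trans ?_
  refine (Finset.sum_le_sum fun j _ =>
    drawsLaw_deviation_gt_le q upd (hX j) (hV j) hVpos hΛ hN hbN hn θ).trans_eq ?_
  rw [Finset.sum_const, Finset.card_univ, nsmul_eq_mul, ENNReal.ofReal_mul (Nat.cast_nonneg _),
    ENNReal.ofReal_natCast]

end AdaptiveDraws

/-! ### Returns and the Lagrangian -/

namespace MDP

variable {S : Type u} {A : Type v} (M : MDP S A) (π : Policy S A)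

theorem abs_reward_le (s : S) (a : A) : |M.reward s a| ≤ 1 :=
  abs_le.2 ⟨by linarith [(M.reward_mem s a).1], (M.reward_mem s a).2⟩

theorem stateLaw_eq_bind (ν : PMF S) (t : ℕ) :
    M.stateLaw π ν t = ν.bind fun s => M.stateLaw π (PMF.pure s) t := by
  induction t with
  | zero => simp [stateLaw]
  | succ t ih => simp only [stateLaw, ih, PMF.bind_bind]

theorem stateLaw_succ' (ν : PMF S) (t : ℕ) :
    M.stateLaw π ν (t + 1) =
      M.stateLaw π (ν.bind fun s => (π s).bind fun a => M.trans s a) t := by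
  induction t with
  | zero => rfl
  | succ t ih =>
    rw [stateLaw, ih]
    rfl

theorem summable_pow_mul_of_abs_le_one {γ : ℝ} (hγ0 : 0 ≤ γ) (hγ1 : γ < 1) {f : ℕ → ℝ}
    (hf : ∀ t, |f t| ≤ 1) : Summable fun t => γ ^ t * f t := by
  refine Summable.of_norm_bounded (summable_geometric_of_lt_one hγ0 hγ1) fun t => ?_
  rw [norm_mul, norm_pow, Real.norm_of_nonneg hγ0]
  exact mul_le_of_le_one_right (pow_nonneg hγ0 t) (hf t)

variable [Fintype S] {γ : ℝ}

theorem advantage_eq (v : S → ℝ) :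
    M.advantage γ v =
      fun z => M.reward z.1 z.2 + (γ * expect (M.trans z.1 z.2) v - v z.1) / (1 - γ) := rfl

theorem lagrangian_eq [Fintype A] (v : S → ℝ) (μ : S × A → ℝ) :
    M.lagrangian γ v μ = expect M.init v + ∑ z, μ z * M.advantage γ v z := rfl

theorem residual_eq [Fintype A] (x x' : Decision S A) :
    M.residual γ x x' = M.lagrangian γ x.1 x'.2 - M.lagrangian γ x'.1 x.2 := by
  simp [residual, bifun]

section Value

variable [Fintype A]

theorem expReward_eq (s : S) (t : ℕ) :
    M.expReward π s t =
      expect (M.stateLaw π (PMF.pure s) t) fun s' => expect (π s') (M.reward s') := rfl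

theorem expReward_zero (s : S) : M.expReward π s 0 = expect (π s) (M.reward s) := by
  simp [expReward_eq, stateLaw]

theorem expReward_succ (s : S) (t : ℕ) :
    M.expReward π s (t + 1) =
      expect (π s) fun a => expect (M.trans s a) fun s' => M.expReward π s' t := by
  rw [expReward_eq, stateLaw_succ', stateLaw_eq_bind]
  simp [expReward_eq]

theorem abs_expReward_le (s : S) (t : ℕ) : |M.expReward π s t| ≤ 1 :=
  abs_expect_le _ fun s' => abs_expect_le _ fun a => M.abs_reward_le s' a

theorem summable_pow_mul_expReward (hγ0 : 0 ≤ γ) (hγ1 : γ < 1) (s : S) :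
    Summable fun t => γ ^ t * M.expReward π s t :=
  summable_pow_mul_of_abs_le_one hγ0 hγ1 (M.abs_expReward_le π s)

theorem expect_value_eq_tsum (hγ0 : 0 ≤ γ) (hγ1 : γ < 1) (ν : PMF S) :
    expect ν (M.value γ π) = (1 - γ) * ∑' t, γ ^ t * expect ν fun s => M.expReward π s t := by
  have value_def : M.value γ π = fun s => (1 - γ) * ∑' t, γ ^ t * M.expReward π s t := rfl
  simp only [value_def, expect_const_mul,
    expect_tsum _ fun s => M.summable_pow_mul_expReward π hγ0 hγ1 s]

theorem value_eq_bellman (hγ0 : 0 ≤ γ) (hγ1 : γ < 1) (s : S) :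
    M.value γ π s = (1 - γ) * expect (π s) (M.reward s) +
      γ * expect (π s) fun a => expect (M.trans s a) (M.value γ π) := by
  have next_value : (expect (π s) fun a => expect (M.trans s a) (M.value γ π)) =
      (1 - γ) * ∑' t, γ ^ t * M.expReward π s (t + 1) := by
    rw [← expect_bind, M.expect_value_eq_tsum π hγ0 hγ1]
    simp only [expect_bind, expReward_succ]
  rw [next_value, value, (M.summable_pow_mul_expReward π hγ0 hγ1 s).tsum_eq_zero_add, pow_zero,
    one_mul, expReward_zero]
  simp only [pow_succ', mul_assoc, tsum_mul_left]
  ring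

theorem expect_advantage (v : S → ℝ) (s : S) :
    (expect (π s) fun a => M.advantage γ v (s, a)) = expect (π s) (M.reward s) +
      (γ * (expect (π s) fun a => expect (M.trans s a) v) - v s) / (1 - γ) := by
  simp only [advantage_eq, expect_add, expect_div_const, expect_sub, expect_const_mul,
    expect_const]

theorem expect_advantage_value (hγ0 : 0 ≤ γ) (hγ1 : γ < 1) (s : S) :
    (expect (π s) fun a => M.advantage γ (M.value γ π) (s, a)) = 0 := by
  have one_sub_ne : 1 - γ ≠ 0 := by linarith
  rw [expect_advantage, M.value_eq_bellman π hγ0 hγ1 s]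
  field_simp
  ring

theorem lagrangian_value_of_isInducedBy (hγ0 : 0 ≤ γ) (hγ1 : γ < 1) {μ : S × A → ℝ}
    (hμ : IsInducedBy π μ) : M.lagrangian γ (M.value γ π) μ = M.ret γ π := by
  rw [lagrangian, ret, add_eq_left, Fintype.sum_prod_type]
  refine Finset.sum_eq_zero fun s _ => ?_
  calc _ = (∑ b, μ (s, b)) * expect (π s) fun a => M.advantage γ (M.value γ π) (s, a) := by
        rw [expect, Finset.mul_sum]
        refine Finset.sum_congr rfl fun a _ => ?_
        rw [← hμ s a]
        ring
    _ = 0 := by rw [M.expect_advantage_value π hγ0 hγ1, mul_zero]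

end Value

section Occupancy

theorem sum_avgState_mul_eq_tsum (hγ0 : 0 ≤ γ) (hγ1 : γ < 1) (f : S → ℝ) :
    ∑ s, M.avgState γ π s * f s =
      (1 - γ) * ∑' t, γ ^ t * expect (M.stateLaw π M.init t) f := by
  have summable_state : ∀ s, Summable fun t =>
      γ ^ t * (M.stateLaw π M.init t s).toReal * f s := fun s => by
    refine (summable_pow_mul_of_abs_le_one hγ0 hγ1 fun t => ?_).mul_right (f s)
    rw [abs_of_nonneg ENNReal.toReal_nonneg]
    exact ENNReal.toReal_le_of_le_ofReal zero_le_one (by simpa using PMF.coe_le_one _ _)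
  simp only [avgState, expect, Finset.mul_sum, ← mul_assoc]
  rw [Summable.tsum_finsetSum fun s _ => summable_state s, Finset.mul_sum]
  simp only [← tsum_mul_right, mul_assoc]

theorem summable_pow_mul_expect_stateLaw (hγ0 : 0 ≤ γ) (hγ1 : γ < 1) (f : S → ℝ) :
    Summable fun t => γ ^ t * expect (M.stateLaw π M.init t) f := by
  refine Summable.of_norm_bounded
    ((summable_geometric_of_lt_one hγ0 hγ1).mul_right (∑ s, |f s|)) fun t => ?_
  rw [norm_mul, norm_pow, Real.norm_of_nonneg hγ0]
  refine mul_le_mul_of_nonneg_left (abs_expect_le _ fun s => ?_) (pow_nonneg hγ0 t)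
  exact Finset.single_le_sum (fun s _ => abs_nonneg (f s)) (Finset.mem_univ s)

variable [Fintype A]

theorem sum_avgState_mul_eq_flow (hγ0 : 0 ≤ γ) (hγ1 : γ < 1) (f : S → ℝ) :
    ∑ s, M.avgState γ π s * f s = (1 - γ) * expect M.init f +
      γ * ∑ s, M.avgState γ π s * expect (π s) fun a => expect (M.trans s a) f := by
  rw [M.sum_avgState_mul_eq_tsum π hγ0 hγ1, M.sum_avgState_mul_eq_tsum π hγ0 hγ1,
    (M.summable_pow_mul_expect_stateLaw π hγ0 hγ1 f).tsum_eq_zero_add, pow_zero, one_mul]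
  simp only [stateLaw, expect_bind, pow_succ', mul_assoc, tsum_mul_left]
  ring

theorem sum_occupancy_mul (f : S × A → ℝ) :
    ∑ z, M.occupancy γ π z * f z =
      ∑ s, M.avgState γ π s * expect (π s) fun a => f (s, a) := by
  simp only [Fintype.sum_prod_type, occupancy, expect, Finset.mul_sum, mul_assoc]

theorem lagrangian_occupancy (hγ0 : 0 ≤ γ) (hγ1 : γ < 1) (v : S → ℝ) :
    M.lagrangian γ v (M.occupancy γ π) =
      ∑ s, M.avgState γ π s * expect (π s) (M.reward s) := by
  have flow := M.sum_avgState_mul_eq_flow π hγ0 hγ1 v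
  have one_sub_ne : 1 - γ ≠ 0 := by linarith
  rw [lagrangian_eq, sum_occupancy_mul]
  simp only [expect_advantage, mul_add, Finset.sum_add_distrib, mul_div_assoc', mul_sub,
    ← Finset.sum_div, Finset.sum_sub_distrib, mul_left_comm _ γ, ← Finset.mul_sum]
  rw [flow]
  field_simp
  ring

theorem lagrangian_occupancy_eq_ret (hγ0 : 0 ≤ γ) (hγ1 : γ < 1) (v : S → ℝ) :
    M.lagrangian γ v (M.occupancy γ π) = M.ret γ π := by
  rw [M.lagrangian_occupancy π hγ0 hγ1 v, ← M.lagrangian_occupancy π hγ0 hγ1 (M.value γ π)]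
  refine M.lagrangian_value_of_isInducedBy π hγ0 hγ1 fun s a => ?_
  simp only [occupancy, ← Finset.mul_sum, sum_toReal_eq_one, mul_one]
  exact mul_comm _ _

theorem residual_value_occupancy (hγ0 : 0 ≤ γ) (hγ1 : γ < 1) {πhat : Policy S A}
    {x : Decision S A} (hx : IsInducedBy πhat x.2) :
    M.residual γ x (M.value γ πhat, M.occupancy γ π) = M.ret γ π - M.ret γ πhat := by
  rw [residual_eq, M.lagrangian_occupancy_eq_ret π hγ0 hγ1,
    M.lagrangian_value_of_isInducedBy πhat hγ0 hγ1 hx]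

end Occupancy

end MDP

/-! ### Exponential weights -/

section ExpWeights

variable {ι : Type*} [Fintype ι]

/-- The relative entropy `KL(q ‖ w)` of two points of the probability simplex, where `w` has no
vanishing coordinate. -/
def relEntropy (q w : ι → ℝ) : ℝ := ∑ k, q k * Real.log (q k / w k)

theorem relEntropy_self {w : ι → ℝ} (hw : ∀ k, 0 < w k) : relEntropy w w = 0 := by
  simp [relEntropy, div_self (hw _).ne']

theorem relEntropy_eq_sum_klFun {q w : ι → ℝ} (hq : q ∈ stdSimplex ℝ ι) (hw : w ∈ stdSimplex ℝ ι)
    (hw0 : ∀ k, 0 < w k) :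
    relEntropy q w = ∑ k, w k * InformationTheory.klFun (q k / w k) := by
  have term_eq : ∀ k, w k * InformationTheory.klFun (q k / w k) =
      q k * Real.log (q k / w k) + w k - q k := fun k => by
    have := (hw0 k).ne'
    rw [InformationTheory.klFun]
    field_simp
  simp only [term_eq, Finset.sum_sub_distrib, Finset.sum_add_distrib, hq.2, hw.2, relEntropy]
  ring

theorem mul_klFun_nonneg {q w : ι → ℝ} (hq : q ∈ stdSimplex ℝ ι) (hw0 : ∀ k, 0 < w k) (k : ι) :
    0 ≤ w k * InformationTheory.klFun (q k / w k) :=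
  mul_nonneg (hw0 k).le (InformationTheory.klFun_nonneg (div_nonneg (hq.1 k) (hw0 k).le))

theorem relEntropy_nonneg {q w : ι → ℝ} (hq : q ∈ stdSimplex ℝ ι) (hw : w ∈ stdSimplex ℝ ι)
    (hw0 : ∀ k, 0 < w k) : 0 ≤ relEntropy q w := by
  rw [relEntropy_eq_sum_klFun hq hw hw0]
  exact Finset.sum_nonneg fun k _ => mul_klFun_nonneg hq hw0 k

theorem eq_of_relEntropy_nonpos {q w : ι → ℝ} (hq : q ∈ stdSimplex ℝ ι)
    (hw : w ∈ stdSimplex ℝ ι) (hw0 : ∀ k, 0 < w k) (h : relEntropy q w ≤ 0) : q = w := by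
  have sum_eq_zero := le_antisymm h (relEntropy_nonneg hq hw hw0)
  rw [relEntropy_eq_sum_klFun hq hw hw0,
    Finset.sum_eq_zero_iff_of_nonneg fun k _ => mul_klFun_nonneg hq hw0 k] at sum_eq_zero
  funext k
  have klFun_eq_zero :=
    (mul_eq_zero.1 (sum_eq_zero k (Finset.mem_univ k))).resolve_left (hw0 k).ne'
  rw [InformationTheory.klFun_eq_zero_iff (div_nonneg (hq.1 k) (hw0 k).le)] at klFun_eq_zero
  exact (div_eq_one_iff_eq (hw0 k).ne').1 klFun_eq_zero

theorem relEntropy_uniform_le {q : ι → ℝ} (hq : q ∈ stdSimplex ℝ ι) :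
    relEntropy q (fun _ => 1 / (Fintype.card ι : ℝ)) ≤ Real.log (Fintype.card ι) := by
  calc relEntropy q (fun _ => 1 / (Fintype.card ι : ℝ))
      ≤ ∑ k, q k * Real.log (Fintype.card ι) := by
        refine Finset.sum_le_sum fun k _ => ?_
        rcases (hq.1 k).eq_or_lt with hk | hk
        · simp [← hk]
        have card_pos : (0 : ℝ) < Fintype.card ι := Nat.cast_pos.2 (Fintype.card_pos_iff.2 ⟨k⟩)
        rw [div_div_eq_mul_div, div_one]
        gcongr
        exact mul_le_of_le_one_left card_pos.le (mem_Icc_of_mem_stdSimplex hq k).2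
    _ = Real.log (Fintype.card ι) := by rw [← Finset.sum_mul, hq.2, one_mul]

/-- The normalizing constant of the exponential weights update of `θ` with losses `c`. -/
def partition (c θ : ι → ℝ) : ℝ := ∑ j, θ j * Real.exp (-c j)

/-- The exponential weights update of `θ` with losses `c`. -/
def expWeights (c θ : ι → ℝ) (k : ι) : ℝ := θ k * Real.exp (-c k) / partition c θ

variable {c θ : ι → ℝ}

theorem partition_pos (hθ : θ ∈ stdSimplex ℝ ι) (hθ0 : ∀ k, 0 < θ k) : 0 < partition c θ := by
  refine Finset.sum_pos (fun j _ => mul_pos (hθ0 j) (Real.exp_pos _))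
    (Finset.nonempty_of_sum_ne_zero (f := θ) ?_)
  rw [hθ.2]
  exact one_ne_zero

theorem expWeights_pos (hθ : θ ∈ stdSimplex ℝ ι) (hθ0 : ∀ k, 0 < θ k) (k : ι) :
    0 < expWeights c θ k :=
  div_pos (mul_pos (hθ0 k) (Real.exp_pos _)) (partition_pos hθ hθ0)

theorem expWeights_mem_stdSimplex (hθ : θ ∈ stdSimplex ℝ ι) (hθ0 : ∀ k, 0 < θ k) :
    expWeights c θ ∈ stdSimplex ℝ ι := by
  refine ⟨fun k => (expWeights_pos hθ hθ0 k).le, ?_⟩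
  simp only [expWeights, ← Finset.sum_div]
  exact div_self (partition_pos hθ hθ0).ne'

theorem log_expWeights (hθ : θ ∈ stdSimplex ℝ ι) (hθ0 : ∀ k, 0 < θ k) (k : ι) :
    Real.log (expWeights c θ k) = Real.log (θ k) - c k - Real.log (partition c θ) := by
  rw [expWeights, Real.log_div (mul_pos (hθ0 k) (Real.exp_pos _)).ne' (partition_pos hθ hθ0).ne',
    Real.log_mul (hθ0 k).ne' (Real.exp_pos _).ne', Real.log_exp]
  ring

theorem sum_mul_add_relEntropy (hθ : θ ∈ stdSimplex ℝ ι) (hθ0 : ∀ k, 0 < θ k) {q : ι → ℝ}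
    (hq : q ∈ stdSimplex ℝ ι) :
    ∑ k, c k * q k + relEntropy q θ =
      relEntropy q (expWeights c θ) - Real.log (partition c θ) := by
  have term_eq : ∀ k, c k * q k + q k * Real.log (q k / θ k) =
      q k * Real.log (q k / expWeights c θ k) - q k * Real.log (partition c θ) := fun k => by
    rcases (hq.1 k).eq_or_lt with hk | hk
    · simp [← hk]
    · rw [Real.log_div hk.ne' (hθ0 k).ne', Real.log_div hk.ne' (expWeights_pos hθ hθ0 k).ne',
        log_expWeights hθ hθ0]
      ring
  simp only [relEntropy]
  rw [← Finset.sum_add_distrib, Finset.sum_congr rfl fun k _ => term_eq k, Finset.sum_sub_distrib,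
    ← Finset.sum_mul, hq.2, one_mul]

theorem log_partition_le (hθ : θ ∈ stdSimplex ℝ ι) (hθ0 : ∀ k, 0 < θ k) (hc : ∀ k, |c k| ≤ 1) :
    Real.log (partition c θ) ≤ -∑ k, c k * θ k + ∑ k, θ k * c k ^ 2 := by
  have partition_le : partition c θ ≤ ∑ j, (θ j - c j * θ j + θ j * c j ^ 2) :=
    Finset.sum_le_sum fun j _ => by
      have := mul_le_mul_of_nonneg_left
        (exp_le_one_add_add_sq (x := -c j) (by rw [abs_neg]; exact hc j)) (hθ0 j).le
      linarith
  rw [Finset.sum_add_distrib, Finset.sum_sub_distrib, hθ.2] at partition_le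
  linarith [Real.log_le_sub_one_of_pos (partition_pos (c := c) hθ hθ0)]

theorem sum_mul_sub_sum_mul_le_expWeights (hθ : θ ∈ stdSimplex ℝ ι) (hθ0 : ∀ k, 0 < θ k)
    (hc : ∀ k, |c k| ≤ 1) {q : ι → ℝ} (hq : q ∈ stdSimplex ℝ ι) :
    ∑ k, c k * θ k - ∑ k, c k * q k ≤
      relEntropy q θ - relEntropy q (expWeights c θ) + ∑ k, θ k * c k ^ 2 := by
  linarith [sum_mul_add_relEntropy (c := c) hθ hθ0 hq, log_partition_le hθ hθ0 hc]

end ExpWeights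

/-! ### One step of mirror descent -/

section ProximalStep

variable {E : Type*} [NormedAddCommGroup E] [InnerProductSpace ℝ E] {K : Set E} {g x x' y : E}
  {a : ℝ}

theorem inner_add_mul_inner_nonneg_of_isMinOn (hK : Convex ℝ K) (hx' : x' ∈ K)
    (hmin : IsMinOn (fun y => inner ℝ g y + a * ‖y - x‖ ^ 2) K x') (hy : y ∈ K) :
    0 ≤ inner ℝ g (y - x') + 2 * a * inner ℝ (x' - x) (y - x') := by
  have hasFDeriv := ((innerSL ℝ g).hasFDerivAt (x := x')).add
    ((((hasFDerivAt_id x').sub_const x).norm_sq).const_mul a)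
  have := hmin.localize.hasFDerivWithinAt_nonneg hasFDeriv.hasFDerivWithinAt
    (sub_mem_posTangentConeAt_of_segment_subset (hK.segment_subset hx' hy))
  simpa [inner_sub_left, mul_assoc, mul_left_comm] using this

theorem inner_sub_le_of_isMinOn (hK : Convex ℝ K) (ha : 0 < a) (hx' : x' ∈ K)
    (hmin : IsMinOn (fun y => inner ℝ g y + a * ‖y - x‖ ^ 2) K x') (hy : y ∈ K) :
    inner ℝ g (x - y) ≤ a * ‖y - x‖ ^ 2 - a * ‖y - x'‖ ^ 2 + ‖g‖ ^ 2 / (4 * a) := by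
  have optimality := inner_add_mul_inner_nonneg_of_isMinOn hK hx' hmin hy
  have norm_sq_eq : ‖y - x‖ ^ 2 =
      ‖x' - x‖ ^ 2 + 2 * inner ℝ (x' - x) (y - x') + ‖y - x'‖ ^ 2 := by
    rw [← norm_add_sq_real]
    congr 2
    abel
  have inner_eq : inner ℝ g (x - y) = -inner ℝ g (y - x') - inner ℝ g (x' - x) := by
    rw [← inner_neg_right, ← inner_sub_right]
    congr 1
    abel
  have young : -inner ℝ g (x' - x) ≤ a * ‖x' - x‖ ^ 2 + ‖g‖ ^ 2 / (4 * a) := by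
    have sq_nonneg : 0 ≤ (2 * a * ‖x' - x‖ - ‖g‖) ^ 2 / (4 * a) := by positivity
    have sq_eq : (2 * a * ‖x' - x‖ - ‖g‖) ^ 2 / (4 * a) =
        a * ‖x' - x‖ ^ 2 + ‖g‖ ^ 2 / (4 * a) - ‖g‖ * ‖x' - x‖ := by
      field_simp
      ring
    linarith [(neg_le_abs _).trans (abs_real_inner_le_norm g (x' - x))]
  rw [norm_sq_eq, inner_eq]
  linarith

end ProximalStep

section Update

variable {dv dμ : ℕ} {Cv : ℝ}

/-- The pairing `⟨g, θ⟩` of a gradient with a parameter. -/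
def pairing (g : (Fin dv → ℝ) × (Fin dμ → ℝ)) (θ : paramSet dv dμ Cv) : ℝ :=
  ∑ i, g.1 i * θ.1.1 i + ∑ k, g.2 k * θ.1.2 k

/-- The second-order term of the mirror descent analysis at `θ`: half of the squared dual norm of
the `v`-part of `g`, plus the squared local norm of its `μ`-part. -/
def localNormSq (θ : paramSet dv dμ Cv) (g : (Fin dv → ℝ) × (Fin dμ → ℝ)) : ℝ :=
  Cv ^ 2 / (2 * dv) * ∑ i, g.1 i ^ 2 + ∑ k, θ.1.2 k * g.2 k ^ 2

theorem bregman_eq (ϑ θ : paramSet dv dμ Cv) :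
    bregman ϑ θ = dv / (2 * Cv ^ 2) * ‖ϑ.1.1 - θ.1.1‖ ^ 2 + relEntropy ϑ.1.2 θ.1.2 := rfl

theorem bregman_nonneg {ϑ θ : paramSet dv dμ Cv} (hθ : ∀ k, 0 < θ.1.2 k) : 0 ≤ bregman ϑ θ :=
  add_nonneg (by positivity) (relEntropy_nonneg ϑ.2.2 θ.2.2 hθ)

theorem bregman_le_of_uniform [NeZero dv] (hCv : 0 < Cv) {ϑ θ : paramSet dv dμ Cv}
    (hθ : ∀ k, θ.1.2 k = 1 / dμ) : bregman ϑ θ ≤ 2 + Real.log dμ := by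
  have hdv : (0 : ℝ) < dv := Nat.cast_pos.2 (NeZero.pos dv)
  have norm_sub_le : ‖ϑ.1.1 - θ.1.1‖ ≤ 2 * (Cv / Real.sqrt dv) := by
    linarith [norm_sub_le ϑ.1.1 θ.1.1, ϑ.2.1, θ.2.1]
  have relEntropy_le := relEntropy_uniform_le ϑ.2.2
  rw [Fintype.card_fin, ← funext hθ] at relEntropy_le
  rw [bregman_eq]
  refine add_le_add ?_ relEntropy_le
  calc dv / (2 * Cv ^ 2) * ‖ϑ.1.1 - θ.1.1‖ ^ 2
      ≤ dv / (2 * Cv ^ 2) * (2 * (Cv / Real.sqrt dv)) ^ 2 := by gcongr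
    _ = 2 := by
      rw [mul_pow, div_pow, Real.sq_sqrt hdv.le]
      field_simp

theorem sum_mul_eq_inner (g : Fin dv → ℝ) (x : EuclideanSpace ℝ (Fin dv)) :
    ∑ i, g i * x i = inner ℝ (WithLp.toLp 2 g) x := by
  simp [PiLp.inner_apply, mul_comm]

theorem sum_sq_eq_norm_sq (g : Fin dv → ℝ) : ∑ i, g i ^ 2 = ‖WithLp.toLp 2 g‖ ^ 2 := by
  simp [EuclideanSpace.norm_sq_eq]

variable {η : ℝ} (hη : 0 < η) (g : (Fin dv → ℝ) × (Fin dμ → ℝ)) {θ : paramSet dv dμ Cv}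
  (hθ : ∀ k, 0 < θ.1.2 k)

include hη hθ

/-- The objective separates into a proximal step in `θ_v` and the relative entropy of `θ_μ` to the
exponential weights update. -/
theorem stepObjective_eq (ϑ : paramSet dv dμ Cv) :
    stepObjective η g θ ϑ =
      (inner ℝ (WithLp.toLp 2 g.1) ϑ.1.1 +
        1 / η * (dv / (2 * Cv ^ 2)) * ‖ϑ.1.1 - θ.1.1‖ ^ 2) +
      1 / η * (relEntropy ϑ.1.2 (expWeights (η • g.2) θ.1.2) -
        Real.log (partition (η • g.2) θ.1.2)) := by
  have three_point := sum_mul_add_relEntropy (c := η • g.2) θ.2.2 hθ ϑ.2.2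
  simp only [Pi.smul_apply, smul_eq_mul, mul_assoc, ← Finset.mul_sum] at three_point
  rw [← three_point, stepObjective, bregman_eq, sum_mul_eq_inner]
  field_simp
  ring

theorem exists_forall_stepObjective_le :
    ∃ θ' : paramSet dv dμ Cv, ∀ ϑ, stepObjective η g θ θ' ≤ stepObjective η g θ ϑ := by
  obtain ⟨x, hx, hmin⟩ := (isCompact_closedBall (0 : EuclideanSpace ℝ (Fin dv))
    (Cv / Real.sqrt dv)).exists_isMinOn ⟨θ.1.1, by simpa using θ.2.1⟩
    (f := fun x => inner ℝ (WithLp.toLp 2 g.1) x +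
      1 / η * (dv / (2 * Cv ^ 2)) * ‖x - θ.1.1‖ ^ 2) (by fun_prop)
  have hw := expWeights_mem_stdSimplex (c := η • g.2) θ.2.2 hθ
  have hw0 := expWeights_pos (c := η • g.2) θ.2.2 hθ
  refine ⟨⟨(x, expWeights (η • g.2) θ.1.2), by simpa using hx, hw⟩, fun ϑ => ?_⟩
  rw [stepObjective_eq hη g hθ, stepObjective_eq hη g hθ, relEntropy_self hw0]
  refine add_le_add (hmin (by simpa using ϑ.2.1)) ?_
  gcongr
  exact relEntropy_nonneg ϑ.2.2 hw hw0

theorem stepObjective_mdUpdate_le (ϑ : paramSet dv dμ Cv) :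
    stepObjective η g θ (mdUpdate η g θ) ≤ stepObjective η g θ ϑ :=
  Classical.epsilon_spec (exists_forall_stepObjective_le hη g hθ) ϑ

theorem mdUpdate_snd : (mdUpdate η g θ).1.2 = expWeights (η • g.2) θ.1.2 := by
  have hw := expWeights_mem_stdSimplex (c := η • g.2) θ.2.2 hθ
  have hw0 := expWeights_pos (c := η • g.2) θ.2.2 hθ
  set θ' := mdUpdate η g θ with hθ'
  have step_le := stepObjective_mdUpdate_le hη g hθ
    ⟨(θ'.1.1, expWeights (η • g.2) θ.1.2), θ'.2.1, hw⟩
  rw [← hθ', stepObjective_eq hη g hθ, stepObjective_eq hη g hθ, add_le_add_iff_left,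
    mul_le_mul_iff_right₀ (one_div_pos.2 hη), sub_le_sub_iff_right, relEntropy_self hw0] at step_le
  exact eq_of_relEntropy_nonpos θ'.2.2 hw hw0 step_le

theorem mdUpdate_snd_pos (k : Fin dμ) : 0 < (mdUpdate η g θ).1.2 k := by
  rw [mdUpdate_snd hη g hθ]
  exact expWeights_pos θ.2.2 hθ k

theorem isMinOn_mdUpdate_fst :
    IsMinOn (fun x => inner ℝ (WithLp.toLp 2 g.1) x +
      1 / η * (dv / (2 * Cv ^ 2)) * ‖x - θ.1.1‖ ^ 2)
      (Metric.closedBall (0 : EuclideanSpace ℝ (Fin dv)) (Cv / Real.sqrt dv))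
      (mdUpdate η g θ).1.1 := fun y hy => by
  have step_le := stepObjective_mdUpdate_le hη g hθ
    ⟨(y, (mdUpdate η g θ).1.2), by simpa using hy, (mdUpdate η g θ).2.2⟩
  rwa [stepObjective_eq hη g hθ, stepObjective_eq hη g hθ, add_le_add_iff_right] at step_le

variable [NeZero dv] (hCv : 0 < Cv)

include hCv

theorem mul_sum_fst_sub_le (ϑ : paramSet dv dμ Cv) :
    η * (∑ i, g.1 i * θ.1.1 i - ∑ i, g.1 i * ϑ.1.1 i) ≤
      dv / (2 * Cv ^ 2) * ‖ϑ.1.1 - θ.1.1‖ ^ 2 -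
        dv / (2 * Cv ^ 2) * ‖ϑ.1.1 - (mdUpdate η g θ).1.1‖ ^ 2 +
        η ^ 2 * (Cv ^ 2 / (2 * dv) * ∑ i, g.1 i ^ 2) := by
  have hdv : (0 : ℝ) < dv := Nat.cast_pos.2 (NeZero.pos dv)
  have proximal := inner_sub_le_of_isMinOn (convex_closedBall _ _) (by positivity)
    (by simpa using (mdUpdate η g θ).2.1) (isMinOn_mdUpdate_fst hη g hθ)
    (y := ϑ.1.1) (by simpa using ϑ.2.1)
  rw [sum_mul_eq_inner, sum_mul_eq_inner, ← inner_sub_right, sum_sq_eq_norm_sq]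
  refine (mul_le_mul_of_nonneg_left proximal hη.le).trans_eq ?_
  field_simp
  ring

theorem mul_pairing_sub_le (hg : ∀ k, |η * g.2 k| ≤ 1) (ϑ : paramSet dv dμ Cv) :
    η * (pairing g θ - pairing g ϑ) ≤
      bregman ϑ θ - bregman ϑ (mdUpdate η g θ) + η ^ 2 * localNormSq θ g := by
  have regret_fst := mul_sum_fst_sub_le hη g hθ hCv ϑ
  have regret_snd := sum_mul_sub_sum_mul_le_expWeights (c := η • g.2) θ.2.2 hθ hg ϑ.2.2
  rw [← mdUpdate_snd hη g hθ] at regret_snd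
  simp only [Pi.smul_apply, smul_eq_mul, mul_assoc, ← Finset.mul_sum, mul_pow,
    mul_left_comm _ (η ^ 2)] at regret_snd
  simp only [pairing, localNormSq, bregman_eq]
  linarith

omit g in
theorem mul_sum_pairing_sub_le {Ω : Type*}
    (grad : paramSet dv dμ Cv × Ω → (Fin dv → ℝ) × (Fin dμ → ℝ))
    (hg : ∀ z k, |η * (grad z).2 k| ≤ 1) (ϑ : paramSet dv dμ Cv) (l : List Ω) :
    η * ((steps (fun θ ω => mdUpdate η (grad (θ, ω)) θ) θ l).map fun z =>
        pairing (grad z) z.1 - pairing (grad z) ϑ).sum ≤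
      bregman ϑ θ + η ^ 2 * ((steps (fun θ ω => mdUpdate η (grad (θ, ω)) θ) θ l).map fun z =>
        localNormSq z.1 (grad z)).sum := by
  induction l generalizing θ with
  | nil => simpa [steps] using bregman_nonneg hθ
  | cons ω l ih =>
    have tail := ih (mdUpdate_snd_pos hη (grad (θ, ω)) hθ)
    have head := mul_pairing_sub_le hη (grad (θ, ω)) hθ hCv (hg (θ, ω)) ϑ
    simp only [steps, List.map_cons, List.sum_cons, mul_add]
    linarith

end Update

/-! ### Runs of the algorithm as controlled processes -/

theorem Prog.run_map {S : Type u} {A : Type v} {α β : Type*} (M : MDP S A) (f : α → β)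
    (P : Prog S A α) : (P.map f).run M = (P.run M).map fun o => (f o.1, o.2) := by
  induction P with
  | done x => simp [Prog.map, Prog.run, PMF.pure_map]
  | sampleInit k ih => simp [Prog.map, Prog.run, ih, PMF.map_bind, PMF.map_comp, Function.comp_def]
  | query s a k ih => simp [Prog.map, Prog.run, ih, PMF.map_bind, PMF.map_comp, Function.comp_def]
  | drawPair q k ih => simp [Prog.map, Prog.run, ih, PMF.map_bind]
  | drawIndex q k ih => simp [Prog.map, Prog.run, ih, PMF.map_bind]

/-- The draws made in one round of mirror descent: an initial state, a state-action pair from the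
current mixture and its next state, and a column index, a state-action pair from that column and its
next state. -/
structure Round (S : Type u) (A : Type v) (dμ : ℕ) where
  init : S
  pair : S × A
  next : S
  index : Fin dμ
  colPair : S × A
  colNext : S

instance {S : Type u} {A : Type v} {dμ : ℕ} [Fintype S] [Fintype A] : Fintype (Round S A dμ) :=
  .ofInjective (fun ω => (ω.init, ω.pair, ω.next, ω.index, ω.colPair, ω.colNext))
    fun ω ω' h => by
      cases ω
      cases ω'
      simpa using h

section Run

variable {S : Type u} {A : Type v} {dv dμ : ℕ} {Cv : ℝ} (M : MDP S A) (B : Basis S A dv dμ)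

/-- The law of the draws of one round at the parameter `θ`. -/
def roundLaw [NeZero dμ] (θ : paramSet dv dμ Cv) : PMF (Round S A dμ) :=
  M.init.bind fun s₀ =>
  (B.mixture θ).bind fun z =>
  (M.trans z.1 z.2).bind fun s =>
  (PMF.uniformOfFintype (Fin dμ)).bind fun k =>
  (B.Ψ k).bind fun z' =>
  (M.trans z'.1 z'.2).bind fun s' =>
  PMF.pure ⟨s₀, z, s, k, z', s'⟩

/-- The sampled gradient at a parameter, as a function of the draws of the round. -/
def roundGrad (γ : ℝ) (z : paramSet dv dμ Cv × Round S A dμ) : (Fin dv → ℝ) × (Fin dμ → ℝ) :=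
  (gradV γ B z.2.init z.2.pair.1 z.2.next,
    gradMu γ B z.1 z.2.index z.2.colPair.1 (M.reward z.2.colPair.1 z.2.colPair.2) z.2.colNext)

/-- The mirror descent update, as a function of the draws of the round. -/
def roundUpdate (γ η : ℝ) (θ : paramSet dv dμ Cv) (ω : Round S A dμ) : paramSet dv dμ Cv :=
  mdUpdate η (roundGrad M B γ (θ, ω)) θ

theorem run_mdLoop [NeZero dμ] (γ η : ℝ) (n : ℕ) (θ : paramSet dv dμ Cv) :
    (mdLoop γ η B n θ).run M =
      (drawsLaw (roundLaw M B) (roundUpdate M B γ η) n θ).map fun l =>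
        (iterates (roundUpdate M B γ η) θ l, 3 * n) := by
  induction n generalizing θ with
  | zero => simp [mdLoop, Prog.run, drawsLaw, PMF.pure_map, iterates]
  | succ n ih =>
    simp [mdLoop, Prog.run, Prog.run_map, ih, drawsLaw, roundLaw, PMF.map_bind, PMF.map_comp,
      Function.comp_def, iterates, roundUpdate, roundGrad, mul_add]

/-- The step size `η = (1 - γ) / √(N (C_v² + dim θ_μ))` of the algorithm run with `N` rounds. -/
def stepSize (γ Cv : ℝ) (dμ N : ℕ) : ℝ := (1 - γ) / Real.sqrt (N * (Cv ^ 2 + dμ))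

theorem run_mdForRL [NeZero dμ] (γ : ℝ) (N : ℕ) (θ : paramSet dv dμ Cv) :
    (mdForRL γ B N θ).run M =
      (drawsLaw (roundLaw M B) (roundUpdate M B γ (stepSize γ Cv dμ N)) (N - 1) θ).map fun l =>
        (B.average (iterates (roundUpdate M B γ (stepSize γ Cv dμ N)) θ l), 3 * (N - 1)) := by
  rw [mdForRL, Prog.run_map, run_mdLoop, PMF.map_comp]
  rfl

end Run

/-! ### Bounds for the sampled gradients and the residual -/

section Bounds

variable {S : Type u} {A : Type v} {dv dμ : ℕ} {Cv γ : ℝ}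

/-- A common bound `2 (1 + C_v) / (1 - γ)` for the entries of `g_v`, for those of `g_μ / dim θ_μ`,
and for the Lagrangian on the parametrized decisions. -/
def gradBound (Cv γ : ℝ) : ℝ := 2 * (1 + Cv) / (1 - γ)

theorem gradBound_pos (hCv : 0 < Cv) (hγ1 : γ < 1) : 0 < gradBound Cv γ :=
  div_pos (by positivity) (sub_pos.2 hγ1)

theorem abs_sum_mul_le [NeZero dv] {x : EuclideanSpace ℝ (Fin dv)} (hx : ‖x‖ ≤ Cv / Real.sqrt dv)
    {a : Fin dv → ℝ} {R : ℝ} (ha : ∀ i, |a i| ≤ R) : |∑ i, a i * x i| ≤ Cv * R := by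
  have hR : 0 ≤ R := (abs_nonneg _).trans (ha 0)
  have hdv : (0 : ℝ) < dv := Nat.cast_pos.2 (NeZero.pos dv)
  have norm_le : ‖WithLp.toLp 2 a‖ ≤ Real.sqrt dv * R := by
    refine abs_le_of_sq_le_sq' ?_ (by positivity) |>.2
    rw [← sum_sq_eq_norm_sq, mul_pow, Real.sq_sqrt hdv.le]
    calc ∑ i, a i ^ 2 ≤ ∑ _i : Fin dv, R ^ 2 := by
          refine Finset.sum_le_sum fun i _ => ?_
          rw [← sq_abs]
          gcongr
          exact ha i
      _ = dv * R ^ 2 := by simp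
  rw [sum_mul_eq_inner]
  calc |inner ℝ (WithLp.toLp 2 a) x| ≤ ‖WithLp.toLp 2 a‖ * ‖x‖ := abs_real_inner_le_norm _ _
    _ ≤ (Real.sqrt dv * R) * (Cv / Real.sqrt dv) := by gcongr
    _ = Cv * R := by field_simp

theorem abs_decode_fst_le [NeZero dv] (B : Basis S A dv dμ) (θ : paramSet dv dμ Cv) (s : S) :
    |(B.decode θ).1 s| ≤ Cv :=
  (abs_sum_mul_le θ.2.1 (B.Φ_le s)).trans_eq (mul_one Cv)

theorem abs_discounted_sub_div_le (hγ0 : 0 ≤ γ) (hγ1 : γ < 1) {x y c : ℝ} (hx : |x| ≤ c)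
    (hy : |y| ≤ c) : |(γ * x - y) / (1 - γ)| ≤ (1 + γ) * c / (1 - γ) := by
  have hpos : 0 < 1 - γ := sub_pos.2 hγ1
  rw [abs_div, abs_of_pos hpos]
  gcongr
  calc |γ * x - y| ≤ |γ * x| + |y| := abs_sub _ _
    _ ≤ γ * c + c := by
      rw [abs_mul, abs_of_nonneg hγ0]
      gcongr
    _ = (1 + γ) * c := by ring

theorem abs_gradV_le (hγ0 : 0 ≤ γ) (hγ1 : γ < 1) (B : Basis S A dv dμ) (s₀ s s' : S) (i : Fin dv) :
    |gradV γ B s₀ s s' i| ≤ 2 / (1 - γ) := by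
  have hpos : 0 < 1 - γ := sub_pos.2 hγ1
  calc |gradV γ B s₀ s s' i| ≤ 1 + (1 + γ) * 1 / (1 - γ) :=
        (abs_add_le _ _).trans (add_le_add (B.Φ_le s₀ i)
          (abs_discounted_sub_div_le hγ0 hγ1 (B.Φ_le s' i) (B.Φ_le s i)))
    _ = 2 / (1 - γ) := by
        field_simp
        ring

theorem abs_gradMu_le [NeZero dv] (hγ0 : 0 ≤ γ) (hγ1 : γ < 1) (B : Basis S A dv dμ)
    (θ : paramSet dv dμ Cv) (k : Fin dμ) (s : S) {r : ℝ} (hr : r ∈ Set.Icc (0 : ℝ) 1) (s' : S)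
    (j : Fin dμ) :
    |gradMu γ B θ k s r s' j| ≤ if j = k then dμ * gradBound Cv γ else 0 := by
  have hpos : 0 < 1 - γ := sub_pos.2 hγ1
  have hCv : 0 ≤ Cv := (abs_nonneg _).trans (abs_decode_fst_le B θ s)
  have one_le : 1 ≤ 1 / (1 - γ) := (one_le_div hpos).2 (by linarith)
  have abs_sub_le : |1 / (1 - γ) - r| ≤ 1 / (1 - γ) :=
    abs_le.2 ⟨by linarith [hr.2], by linarith [hr.1]⟩
  rw [gradMu]
  split_ifs
  · rw [abs_mul, Nat.abs_cast]
    gcongr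
    calc _ ≤ 1 / (1 - γ) + (1 + γ) * Cv / (1 - γ) :=
          (abs_sub _ _).trans (add_le_add abs_sub_le (abs_discounted_sub_div_le hγ0 hγ1
            (abs_decode_fst_le B θ s') (abs_decode_fst_le B θ s)))
      _ ≤ gradBound Cv γ := by
          rw [gradBound, ← add_div]
          gcongr
          nlinarith
  · simp

section Lagrangian

variable [Fintype S] [Fintype A] (M : MDP S A) (B : Basis S A dv dμ) (θ ϑ : paramSet dv dμ Cv)

theorem toReal_weights (k : Fin dμ) : (weights θ k).toReal = θ.1.2 k := by
  simp [weights, ENNReal.toReal_ofReal (θ.2.2.1 k)]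

theorem expect_mixture (f : S × A → ℝ) :
    expect (B.mixture θ) f = ∑ k, θ.1.2 k * expect (B.Ψ k) f := by
  rw [Basis.mixture, expect_bind, expect]
  simp only [toReal_weights]

theorem sum_decode_snd_mul (f : S × A → ℝ) :
    ∑ z, (B.decode θ).2 z * f z = expect (B.mixture θ) f := by
  rw [expect]
  refine Finset.sum_congr rfl fun z _ => ?_
  rw [Basis.mixture, toReal_bind_apply, expect, Basis.decode]
  simp only [toReal_weights, mul_comm]

theorem lagrangian_decode (v : S → ℝ) :
    M.lagrangian γ v (B.decode θ).2 =
      expect M.init v + expect (B.mixture θ) (M.advantage γ v) := by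
  rw [MDP.lagrangian_eq, sum_decode_snd_mul]

theorem abs_lagrangian_decode_le [NeZero dv] (hγ0 : 0 ≤ γ) (hγ1 : γ < 1) :
    |M.lagrangian γ (B.decode θ).1 (B.decode ϑ).2| ≤ gradBound Cv γ := by
  have hpos : 0 < 1 - γ := sub_pos.2 hγ1
  have abs_decode_le := abs_decode_fst_le B θ
  have abs_advantage_le : ∀ z, |M.advantage γ (B.decode θ).1 z| ≤ 1 + (1 + γ) * Cv / (1 - γ) :=
    fun z => (abs_add_le _ _).trans (add_le_add (M.abs_reward_le _ _)
      (abs_discounted_sub_div_le hγ0 hγ1 (abs_expect_le _ abs_decode_le) (abs_decode_le _)))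
  calc |M.lagrangian γ (B.decode θ).1 (B.decode ϑ).2|
      ≤ Cv + (1 + (1 + γ) * Cv / (1 - γ)) := by
        rw [lagrangian_decode]
        exact (abs_add_le _ _).trans
          (add_le_add (abs_expect_le _ abs_decode_le) (abs_expect_le _ abs_advantage_le))
    _ = (2 * (1 + Cv) - (1 + γ)) / (1 - γ) := by
        field_simp
        ring
    _ ≤ gradBound Cv γ := by
        rw [gradBound]
        gcongr
        linarith

theorem residual_decode_le [NeZero dv] (hγ0 : 0 ≤ γ) (hγ1 : γ < 1) :
    M.residual γ (B.decode θ) (B.decode ϑ) ≤ 2 * gradBound Cv γ := by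
  rw [MDP.residual_eq]
  linarith [(abs_le.1 (abs_lagrangian_decode_le M B θ ϑ hγ0 hγ1)).2,
    (abs_le.1 (abs_lagrangian_decode_le M B ϑ θ hγ0 hγ1)).1]

end Lagrangian

end Bounds

/-! ### Expected gradients and the average iterate -/

section Residual

variable {S : Type u} {A : Type v} {dv dμ : ℕ} {Cv γ : ℝ} (M : MDP S A) (B : Basis S A dv dμ)

theorem sum_gradV_mul (ϑ : paramSet dv dμ Cv) (s₀ s s' : S) :
    ∑ i, gradV γ B s₀ s s' i * ϑ.1.1 i =
      (B.decode ϑ).1 s₀ + (γ * (B.decode ϑ).1 s' - (B.decode ϑ).1 s) / (1 - γ) := by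
  simp only [gradV, Basis.decode, Finset.mul_sum, ← Finset.sum_sub_distrib, Finset.sum_div,
    ← Finset.sum_add_distrib]
  exact Finset.sum_congr rfl fun i _ => by ring

theorem sum_gradMu_mul (θ ϑ : paramSet dv dμ Cv) (k : Fin dμ) (s : S) (r : ℝ) (s' : S) :
    ∑ j, gradMu γ B θ k s r s' j * ϑ.1.2 j =
      dμ * (1 / (1 - γ) - r - (γ * (B.decode θ).1 s' - (B.decode θ).1 s) / (1 - γ)) *
        ϑ.1.2 k := by
  simp only [gradMu, ite_mul, zero_mul, Finset.sum_ite_eq', Finset.mem_univ, if_true]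

theorem expect_uniform [NeZero dμ] (f : Fin dμ → ℝ) :
    expect (PMF.uniformOfFintype (Fin dμ)) f = (∑ k, f k) / dμ := by
  simp [expect, ← Finset.mul_sum, div_eq_inv_mul]

variable [Fintype S] [Fintype A]

theorem expect_sum_roundGrad_fst_mul [NeZero dμ] (θ ϑ : paramSet dv dμ Cv) :
    (expect (roundLaw M B θ) fun ω => ∑ i, (roundGrad M B γ (θ, ω)).1 i * ϑ.1.1 i) =
      M.lagrangian γ (B.decode ϑ).1 (B.decode θ).2 -
        expect (B.mixture θ) fun z => M.reward z.1 z.2 := by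
  rw [lagrangian_decode, MDP.advantage_eq]
  simp only [roundGrad, sum_gradV_mul, roundLaw, expect_bind, expect_pure, expect_const,
    expect_add, expect_div_const, expect_sub, expect_const_mul]
  ring

theorem expect_sum_roundGrad_snd_mul [NeZero dμ] (θ ϑ : paramSet dv dμ Cv) :
    (expect (roundLaw M B θ) fun ω => ∑ k, (roundGrad M B γ (θ, ω)).2 k * ϑ.1.2 k) =
      1 / (1 - γ) + expect M.init (B.decode θ).1 -
        M.lagrangian γ (B.decode θ).1 (B.decode ϑ).2 := by
  have hdμ : (dμ : ℝ) ≠ 0 := NeZero.ne _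
  have mixture_eq := expect_mixture B ϑ fun z =>
    1 / (1 - γ) - M.advantage γ (B.decode θ).1 z
  rw [expect_sub, expect_const] at mixture_eq
  rw [lagrangian_decode, add_comm (1 / (1 - γ)), add_sub_add_left_eq_sub, mixture_eq]
  simp only [roundGrad, sum_gradMu_mul, roundLaw, expect_bind, expect_pure, expect_const,
    expect_uniform, expect_mul_const, expect_const_mul]
  simp only [mul_assoc, ← Finset.mul_sum, mul_div_cancel_left₀ _ hdμ]
  refine Finset.sum_congr rfl fun k _ => ?_
  simp only [MDP.advantage_eq, expect_sub, expect_add, expect_const, expect_div_const,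
    expect_const_mul]
  ring

theorem expect_pairing_sub [NeZero dμ] (θ ϑ : paramSet dv dμ Cv) :
    (expect (roundLaw M B θ) fun ω =>
      pairing (roundGrad M B γ (θ, ω)) θ - pairing (roundGrad M B γ (θ, ω)) ϑ) =
      M.residual γ (B.decode θ) (B.decode ϑ) := by
  simp only [pairing, expect_sub, expect_add, expect_sum_roundGrad_fst_mul,
    expect_sum_roundGrad_snd_mul, MDP.residual_eq]
  ring

/-- The transition part `v ↦ (γ P - E) v / (1 - γ)` of the advantage function. -/
def MDP.bellmanDrift (γ : ℝ) : (S → ℝ) →ₗ[ℝ] (S × A → ℝ) where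
  toFun v z := (γ * expect (M.trans z.1 z.2) v - v z.1) / (1 - γ)
  map_add' v w := by
    funext z
    rw [Pi.add_def, expect_add, Pi.add_apply]
    ring
  map_smul' c v := by
    funext z
    simp only [Pi.smul_def, smul_eq_mul, expect_const_mul, RingHom.id_apply]
    ring

/-- The linear part of the residual in its first argument. -/
def residualLinear (γ : ℝ) (y : Decision S A) : Decision S A →ₗ[ℝ] ℝ where
  toFun x := expect M.init x.1 + ∑ z, y.2 z * M.bellmanDrift γ x.1 z -
    ∑ z, x.2 z * M.advantage γ y.1 z
  map_add' x x' := by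
    have expect_init_add : expect M.init (x.1 + x'.1) = expect M.init x.1 + expect M.init x'.1 :=
      expect_add _ _ _
    simp only [Prod.fst_add, Prod.snd_add, map_add, Pi.add_apply, expect_init_add,
      mul_add, add_mul, Finset.sum_add_distrib]
    ring
  map_smul' c x := by
    have expect_init_smul : expect M.init (c • x.1) = c * expect M.init x.1 :=
      expect_const_mul _ _ _
    simp only [Prod.smul_fst, Prod.smul_snd, map_smul, Pi.smul_apply, smul_eq_mul,
      expect_init_smul, mul_left_comm _ c, mul_assoc, ← Finset.mul_sum, RingHom.id_apply]
    ring

theorem residual_eq_residualLinear_add (x y : Decision S A) :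
    M.residual γ x y = residualLinear M γ y x +
      (∑ z, y.2 z * M.reward z.1 z.2 - expect M.init y.1) := by
  have advantage_eq : ∀ z, M.advantage γ x.1 z = M.reward z.1 z.2 + M.bellmanDrift γ x.1 z :=
    fun z => rfl
  simp only [MDP.residual_eq, MDP.lagrangian_eq, residualLinear, LinearMap.coe_mk, AddHom.coe_mk,
    advantage_eq, mul_add, Finset.sum_add_distrib]
  ring

theorem length_mul_residual_average (y : Decision S A) {l : List (paramSet dv dμ Cv)}
    (hl : l ≠ []) :
    l.length * M.residual γ (B.average l) y =
      (l.map fun θ => M.residual γ (B.decode θ) y).sum := by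
  have length_ne_zero : (l.length : ℝ) ≠ 0 := by simpa using hl
  simp only [residual_eq_residualLinear_add, List.sum_map_add]
  rw [Basis.average, map_smul, map_list_sum, List.map_map, smul_eq_mul, mul_add,
    mul_inv_cancel_left₀ length_ne_zero]
  simp [Function.comp_def]

end Residual

/-! ### Concentration of the sampled gradients -/

section Concentration

variable {S : Type u} {A : Type v} {dv dμ : ℕ} {Cv γ b : ℝ} (M : MDP S A)
  (B : Basis S A dv dμ)

/-- A function of the parameter and the draws of a round that is of size `b`, up to a peak of size
at most `b * dim θ_μ` at the drawn column index. The peaks are weighted by a subprobability on the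
indices, and the index is uniform, so the second moment is of order `b ^ 2 * dim θ_μ` although the
square of the maximum is of order `(b * dim θ_μ) ^ 2`. -/
def IsModerate (b : ℝ) (X : paramSet dv dμ Cv × Round S A dμ → ℝ) : Prop :=
  ∃ w : paramSet dv dμ Cv → Fin dμ → ℝ, (∀ θ k, 0 ≤ w θ k) ∧ (∀ θ, ∑ k, w θ k ≤ 1) ∧
    ∀ z, |X z| ≤ b * (1 + dμ * w z.1 z.2.index)

namespace IsModerate

variable {X : paramSet dv dμ Cv × Round S A dμ → ℝ}

theorem of_abs_le (h : ∀ z, |X z| ≤ b) : IsModerate b X :=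
  ⟨fun _ _ => 0, fun _ _ => le_rfl, fun _ => by simp, fun z => by simpa using h z⟩

theorem neg (hX : IsModerate b X) : IsModerate b fun z => -X z := by
  simpa only [IsModerate, abs_neg] using hX

theorem abs_le_mul [NeZero dμ] (hX : IsModerate b X) (hb : 0 ≤ b)
    (z : paramSet dv dμ Cv × Round S A dμ) : |X z| ≤ 2 * b * dμ := by
  obtain ⟨w, w_nonneg, w_sum, hX⟩ := hX
  have one_le : (1 : ℝ) ≤ dμ := Nat.one_le_cast.2 (NeZero.pos dμ)
  have w_le : w z.1 z.2.index ≤ 1 :=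
    (Finset.single_le_sum (fun k _ => w_nonneg z.1 k) (Finset.mem_univ _)).trans (w_sum z.1)
  calc |X z| ≤ b * (1 + dμ * w z.1 z.2.index) := hX z
    _ ≤ b * (dμ + dμ * 1) := by gcongr
    _ = 2 * b * dμ := by ring

end IsModerate

/-- The squared local dual norm of `g_μ`, rescaled to the size of the entries of `g_v`. -/
def scaledSq (γ : ℝ) (z : paramSet dv dμ Cv × Round S A dμ) : ℝ :=
  (∑ k, z.1.1.2 k * (roundGrad M B γ z).2 k ^ 2) / (dμ * gradBound Cv γ)

theorem abs_roundGrad_fst_le (hγ0 : 0 ≤ γ) (hγ1 : γ < 1) (z : paramSet dv dμ Cv × Round S A dμ)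
    (i : Fin dv) : |(roundGrad M B γ z).1 i| ≤ 2 / (1 - γ) :=
  abs_gradV_le hγ0 hγ1 B _ _ _ i

theorem abs_roundGrad_snd_le [NeZero dv] (hγ0 : 0 ≤ γ) (hγ1 : γ < 1)
    (z : paramSet dv dμ Cv × Round S A dμ) (k : Fin dμ) :
    |(roundGrad M B γ z).2 k| ≤ if k = z.2.index then dμ * gradBound Cv γ else 0 :=
  abs_gradMu_le hγ0 hγ1 B z.1 _ _ (M.reward_mem _ _) _ k

theorem abs_sum_roundGrad_snd_mul_le [NeZero dv] (hγ0 : 0 ≤ γ) (hγ1 : γ < 1)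
    (z : paramSet dv dμ Cv × Round S A dμ) :
    |∑ k, (roundGrad M B γ z).2 k * z.1.1.2 k| ≤
      dμ * gradBound Cv γ * z.1.1.2 z.2.index := by
  calc _ ≤ ∑ k, |(roundGrad M B γ z).2 k * z.1.1.2 k| := Finset.abs_sum_le_sum_abs _ _
    _ ≤ ∑ k, (if k = z.2.index then dμ * gradBound Cv γ else 0) * z.1.1.2 k := by
        refine Finset.sum_le_sum fun k _ => ?_
        rw [abs_mul, abs_of_nonneg (z.1.2.2.1 k)]
        exact mul_le_mul_of_nonneg_right (abs_roundGrad_snd_le M B hγ0 hγ1 z k) (z.1.2.2.1 k)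
    _ = dμ * gradBound Cv γ * z.1.1.2 z.2.index := by simp

theorem two_div_le_gradBound (hCv : 0 < Cv) (hγ1 : γ < 1) : 2 / (1 - γ) ≤ gradBound Cv γ := by
  have : 0 < 1 - γ := sub_pos.2 hγ1
  rw [gradBound]
  gcongr
  linarith

theorem scaledSq_nonneg (hCv : 0 < Cv) (hγ1 : γ < 1) (z : paramSet dv dμ Cv × Round S A dμ) :
    0 ≤ scaledSq M B γ z :=
  div_nonneg (Finset.sum_nonneg fun k _ => mul_nonneg (z.1.2.2.1 k) (sq_nonneg _))
    (mul_nonneg (Nat.cast_nonneg _) (gradBound_pos hCv hγ1).le)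

theorem scaledSq_le [NeZero dv] [NeZero dμ] (hCv : 0 < Cv) (hγ0 : 0 ≤ γ) (hγ1 : γ < 1)
    (z : paramSet dv dμ Cv × Round S A dμ) :
    scaledSq M B γ z ≤ gradBound Cv γ * (dμ * z.1.1.2 z.2.index) := by
  have bound_pos := gradBound_pos hCv hγ1
  have hdμ : (0 : ℝ) < dμ := Nat.cast_pos.2 (NeZero.pos dμ)
  rw [scaledSq, div_le_iff₀ (by positivity)]
  calc ∑ k, z.1.1.2 k * (roundGrad M B γ z).2 k ^ 2
      ≤ ∑ k, z.1.1.2 k * (if k = z.2.index then dμ * gradBound Cv γ else 0) ^ 2 := by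
        refine Finset.sum_le_sum fun k _ => mul_le_mul_of_nonneg_left ?_ (z.1.2.2.1 k)
        rw [← sq_abs]
        exact pow_le_pow_left₀ (abs_nonneg _) (abs_roundGrad_snd_le M B hγ0 hγ1 z k) 2
    _ = gradBound Cv γ * (dμ * z.1.1.2 z.2.index) * (dμ * gradBound Cv γ) := by
        simp only [ite_pow, ne_eq, OfNat.ofNat_ne_zero, not_false_eq_true, zero_pow, mul_ite,
          mul_zero, Finset.sum_ite_eq', Finset.mem_univ, if_true]
        ring

theorem isModerate_scaledSq [NeZero dv] [NeZero dμ] (hCv : 0 < Cv) (hγ0 : 0 ≤ γ) (hγ1 : γ < 1) :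
    IsModerate (gradBound Cv γ) (scaledSq M B γ (Cv := Cv)) := by
  refine ⟨fun θ => θ.1.2, fun θ => θ.2.2.1, fun θ => θ.2.2.2.le, fun z => ?_⟩
  rw [abs_of_nonneg (scaledSq_nonneg M B hCv hγ1 z)]
  refine (scaledSq_le M B hCv hγ0 hγ1 z).trans ?_
  gcongr
  · exact (gradBound_pos hCv hγ1).le
  · linarith

theorem isModerate_neg_pairing [NeZero dv] (hγ0 : 0 ≤ γ) (hγ1 : γ < 1) :
    IsModerate (Cv := Cv) (gradBound Cv γ) fun z => -pairing (roundGrad M B γ z) z.1 := by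
  refine ⟨fun θ => θ.1.2, fun θ => θ.2.2.1, fun θ => θ.2.2.2.le, fun z => ?_⟩
  have abs_fst_le : |∑ i, (roundGrad M B γ z).1 i * z.1.1.1 i| ≤ gradBound Cv γ := by
    calc _ ≤ Cv * (2 / (1 - γ)) := abs_sum_mul_le z.1.2.1 (abs_roundGrad_fst_le M B hγ0 hγ1 z)
      _ = 2 * Cv / (1 - γ) := by ring
      _ ≤ gradBound Cv γ := by
        rw [gradBound]
        gcongr
        linarith
  rw [abs_neg, pairing]
  calc _ ≤ gradBound Cv γ + dμ * gradBound Cv γ * z.1.1.2 z.2.index :=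
        (abs_add_le _ _).trans
          (add_le_add abs_fst_le (abs_sum_roundGrad_snd_mul_le M B hγ0 hγ1 z))
    _ = gradBound Cv γ * (1 + dμ * z.1.1.2 z.2.index) := by ring

theorem isModerate_roundGrad_fst (hCv : 0 < Cv) (hγ0 : 0 ≤ γ) (hγ1 : γ < 1) (i : Fin dv) :
    IsModerate (Cv := Cv) (gradBound Cv γ) fun z => (roundGrad M B γ z).1 i :=
  .of_abs_le fun z => (abs_roundGrad_fst_le M B hγ0 hγ1 z i).trans (two_div_le_gradBound hCv hγ1)

theorem isModerate_roundGrad_snd [NeZero dv] (hCv : 0 < Cv) (hγ0 : 0 ≤ γ) (hγ1 : γ < 1)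
    (k : Fin dμ) : IsModerate (Cv := Cv) (gradBound Cv γ) fun z => (roundGrad M B γ z).2 k := by
  refine ⟨fun _ => Pi.single k 1, fun _ j => ?_, fun _ => by simp, fun z => ?_⟩
  · simp only [Pi.single_apply]
    split_ifs <;> norm_num
  · refine (abs_roundGrad_snd_le M B hγ0 hγ1 z k).trans ?_
    have bound_pos := gradBound_pos hCv hγ1
    simp only [Pi.single_apply, eq_comm (a := k)]
    split_ifs
    · linarith
    · simpa using bound_pos.le

variable [Fintype S] [Fintype A]

theorem expect_roundLaw_index [NeZero dμ] (θ : paramSet dv dμ Cv) (f : Fin dμ → ℝ) :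
    (expect (roundLaw M B θ) fun ω => f ω.index) = (∑ k, f k) / dμ := by
  simp only [roundLaw, expect_bind, expect_pure, expect_const, expect_uniform]

theorem IsModerate.expect_sq_le [NeZero dμ] {X : paramSet dv dμ Cv × Round S A dμ → ℝ}
    (hX : IsModerate b X) (θ : paramSet dv dμ Cv) :
    expect (roundLaw M B θ) (fun ω => X (θ, ω) ^ 2) ≤ 4 * b ^ 2 * dμ := by
  obtain ⟨w, w_nonneg, w_sum, hX⟩ := hX
  have one_le : (1 : ℝ) ≤ dμ := Nat.one_le_cast.2 (NeZero.pos dμ)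
  have w_le : ∀ k, w θ k ≤ 1 := fun k =>
    (Finset.single_le_sum (fun k _ => w_nonneg θ k) (Finset.mem_univ k)).trans (w_sum θ)
  calc expect (roundLaw M B θ) (fun ω => X (θ, ω) ^ 2)
      ≤ expect (roundLaw M B θ) fun ω => b ^ 2 * (1 + (2 * dμ + dμ ^ 2) * w θ ω.index) := by
        refine expect_mono _ fun ω => ?_
        have w_sq_le : w θ ω.index ^ 2 ≤ w θ ω.index := by
          rw [sq]
          exact mul_le_of_le_one_right (w_nonneg θ _) (w_le _)
        have X_mem := abs_le.1 (hX (θ, ω))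
        calc X (θ, ω) ^ 2 ≤ (b * (1 + dμ * w θ ω.index)) ^ 2 := sq_le_sq' X_mem.1 X_mem.2
          _ = b ^ 2 * (1 + 2 * dμ * w θ ω.index + dμ ^ 2 * w θ ω.index ^ 2) := by ring
          _ ≤ b ^ 2 * (1 + 2 * dμ * w θ ω.index + dμ ^ 2 * w θ ω.index) := by gcongr
          _ = b ^ 2 * (1 + (2 * dμ + dμ ^ 2) * w θ ω.index) := by ring
    _ = b ^ 2 * (1 + (2 + dμ) * ∑ k, w θ k) := by
        rw [expect_const_mul, expect_add, expect_const, expect_const_mul, expect_roundLaw_index]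
        field_simp
    _ ≤ b ^ 2 * (1 + (2 + dμ) * 1) := by
        gcongr
        exact w_sum θ
    _ ≤ 4 * b ^ 2 * dμ := by nlinarith [sq_nonneg b]

theorem expect_scaledSq_le [NeZero dv] [NeZero dμ] (hCv : 0 < Cv) (hγ0 : 0 ≤ γ) (hγ1 : γ < 1)
    (θ : paramSet dv dμ Cv) :
    (expect (roundLaw M B θ) fun ω => scaledSq M B γ (θ, ω)) ≤ gradBound Cv γ := by
  calc _ ≤ expect (roundLaw M B θ) fun ω => gradBound Cv γ * (dμ * θ.1.2 ω.index) :=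
        expect_mono _ fun ω => scaledSq_le M B hCv hγ0 hγ1 (θ, ω)
    _ = gradBound Cv γ := by
        rw [expect_const_mul, expect_const_mul, expect_roundLaw_index, θ.2.2.2,
          mul_one_div_cancel (NeZero.ne _), mul_one]

/-- The steps of a run along which the sampled gradients deviate by at most `R` from their
conditional expectations, in all the directions in which the regret analysis tests them. -/
structure IsTypical [NeZero dμ] (γ R : ℝ) (L : List (paramSet dv dμ Cv × Round S A dμ)) :
    Prop where
  neg_pairing_le :
    deviation (roundLaw M B) L (fun z => -pairing (roundGrad M B γ z) z.1) ≤ R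
  scaledSq_le : deviation (roundLaw M B) L (scaledSq M B γ) ≤ R
  abs_fst_le : ∀ i, |deviation (roundLaw M B) L fun z => (roundGrad M B γ z).1 i| ≤ R
  snd_le : ∀ k, deviation (roundLaw M B) L (fun z => (roundGrad M B γ z).2 k) ≤ R

theorem drawsLaw_not_isTypical_le [NeZero dv] [NeZero dμ] (hCv : 0 < Cv) (hγ0 : 0 ≤ γ)
    (hγ1 : γ < 1) (upd : paramSet dv dμ Cv → Round S A dμ → paramSet dv dμ Cv) {Λ N : ℝ}
    (hΛ : 0 ≤ Λ) (hN : 0 < N) (hΛN : dμ * Λ ≤ N) {n : ℕ} (hn : n ≤ N) (θ : paramSet dv dμ Cv) :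
    (drawsLaw (roundLaw M B) upd n θ).toOuterMeasure
        {l | ¬IsTypical M B γ (4 * gradBound Cv γ * Real.sqrt (N * dμ * Λ)) (steps upd θ l)} ≤
      ENNReal.ofReal (4 * (dv + dμ) * Real.exp (-Λ)) := by
  have bound_pos := gradBound_pos hCv hγ1
  have one_le_dv : (1 : ℝ) ≤ dv := Nat.one_le_cast.2 (NeZero.pos dv)
  have one_le_dμ : (1 : ℝ) ≤ dμ := Nat.one_le_cast.2 (NeZero.pos dμ)
  let X : Fin 2 ⊕ (Fin dv ⊕ Fin dv) ⊕ Fin dμ → paramSet dv dμ Cv × Round S A dμ → ℝ :=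
    Sum.elim ![fun z => -pairing (roundGrad M B γ z) z.1, scaledSq M B γ]
      (Sum.elim (Sum.elim (fun i z => (roundGrad M B γ z).1 i)
        fun i z => -(roundGrad M B γ z).1 i) fun k z => (roundGrad M B γ z).2 k)
  have isModerate_X : ∀ j, IsModerate (gradBound Cv γ) (X j) := by
    rintro (j | (i | i) | k)
    · fin_cases j
      · exact isModerate_neg_pairing M B hγ0 hγ1
      · exact isModerate_scaledSq M B hCv hγ0 hγ1
    · exact isModerate_roundGrad_fst M B hCv hγ0 hγ1 i
    · exact (isModerate_roundGrad_fst M B hCv hγ0 hγ1 i).neg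
    · exact isModerate_roundGrad_snd M B hCv hγ0 hγ1 k
  have radius_eq : 2 * Real.sqrt (N * (4 * gradBound Cv γ ^ 2 * dμ) * Λ) =
      4 * gradBound Cv γ * Real.sqrt (N * dμ * Λ) := by
    rw [show N * (4 * gradBound Cv γ ^ 2 * dμ) * Λ = (2 * gradBound Cv γ) ^ 2 * (N * dμ * Λ) by
      ring, Real.sqrt_mul (sq_nonneg _), Real.sqrt_sq (by positivity)]
    ring
  have tail := drawsLaw_exists_deviation_gt_le (roundLaw M B) upd
    (fun j => (isModerate_X j).abs_le_mul bound_pos.le)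
    (fun j => (isModerate_X j).expect_sq_le M B) (by positivity) hΛ hN
    (by nlinarith [mul_le_mul_of_nonneg_left hΛN (by positivity : 0 ≤ 4 * gradBound Cv γ ^ 2 * dμ)])
    hn θ
  rw [radius_eq] at tail
  refine (MeasureTheory.measure_mono fun l hl => ?_).trans (tail.trans ?_)
  · by_contra! h_le
    simp only [Set.mem_ofPred, not_exists, not_lt] at h_le
    refine hl ⟨h_le (.inl 0), h_le (.inl 1), fun i => abs_le'.2
      ⟨h_le (.inr (.inl (.inl i))), ?_⟩, fun k => h_le (.inr (.inr k))⟩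
    rw [← map_neg]
    exact h_le (.inr (.inl (.inr i)))
  · gcongr
    simp only [Fintype.card_sum, Fintype.card_fin, Nat.cast_add, Nat.cast_ofNat]
    linarith

end Concentration

/-! ### Regret of typical runs -/

section Regret

variable {S : Type u} {A : Type v} {dv dμ : ℕ} {Cv γ : ℝ} (M : MDP S A) (B : Basis S A dv dμ)

theorem stepSize_pos (hγ1 : γ < 1) [NeZero dμ] {N : ℕ} (hN : 0 < N) : 0 < stepSize γ Cv dμ N := by
  have hdμ : (0 : ℝ) < dμ := Nat.cast_pos.2 (NeZero.pos dμ)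
  rw [stepSize]
  positivity

theorem stepSize_sq_mul_sum_le [NeZero dμ] (hγ1 : γ < 1) {N : ℕ} (hN : 0 < N) :
    stepSize γ Cv dμ N ^ 2 * (N * (2 * Cv ^ 2 / (1 - γ) ^ 2 + 5 * dμ * gradBound Cv γ ^ 2)) ≤
      2 + 5 * (2 * (1 + Cv)) ^ 2 := by
  have hpos : 0 < 1 - γ := sub_pos.2 hγ1
  have hdμ : (0 : ℝ) < dμ := Nat.cast_pos.2 (NeZero.pos dμ)
  calc _ = (2 * Cv ^ 2 + 5 * dμ * (2 * (1 + Cv)) ^ 2) / (Cv ^ 2 + dμ) := by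
        rw [stepSize, gradBound, div_pow, Real.sq_sqrt (by positivity)]
        field_simp
    _ ≤ 2 + 5 * (2 * (1 + Cv)) ^ 2 := by
        rw [div_le_iff₀ (by positivity)]
        linarith [show 0 ≤ 5 * (2 * (1 + Cv)) ^ 2 * Cv ^ 2 + 2 * dμ by positivity]

theorem abs_stepSize_mul_roundGrad_snd_le_one [NeZero dv] [NeZero dμ] (hCv : 0 < Cv) (hγ0 : 0 ≤ γ)
    (hγ1 : γ < 1) {N : ℕ} (hN : (2 * (1 + Cv)) ^ 2 * dμ ≤ N)
    (z : paramSet dv dμ Cv × Round S A dμ) (k : Fin dμ) :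
    |stepSize γ Cv dμ N * (roundGrad M B γ z).2 k| ≤ 1 := by
  have hpos : 0 < 1 - γ := sub_pos.2 hγ1
  have hdμ : (0 : ℝ) < dμ := Nat.cast_pos.2 (NeZero.pos dμ)
  have abs_snd_le : |(roundGrad M B γ z).2 k| ≤ dμ * gradBound Cv γ := by
    refine (abs_roundGrad_snd_le M B hγ0 hγ1 z k).trans ?_
    split_ifs
    · rfl
    · exact mul_nonneg hdμ.le (gradBound_pos hCv hγ1).le
  have le_sqrt : dμ * (2 * (1 + Cv)) ≤ Real.sqrt (N * (Cv ^ 2 + dμ)) := by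
    refine Real.le_sqrt_of_sq_le ?_
    calc (dμ * (2 * (1 + Cv))) ^ 2 = (2 * (1 + Cv)) ^ 2 * dμ * dμ := by ring
      _ ≤ N * (Cv ^ 2 + dμ) := by
        gcongr
        linarith [sq_nonneg Cv]
  rw [abs_mul, stepSize, abs_of_nonneg (by positivity)]
  calc (1 - γ) / Real.sqrt (N * (Cv ^ 2 + dμ)) * |(roundGrad M B γ z).2 k|
      ≤ (1 - γ) / Real.sqrt (N * (Cv ^ 2 + dμ)) * (dμ * gradBound Cv γ) := by gcongr
    _ = dμ * (2 * (1 + Cv)) / Real.sqrt (N * (Cv ^ 2 + dμ)) := by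
        rw [gradBound]
        field_simp
    _ ≤ 1 := div_le_one_of_le₀ le_sqrt (Real.sqrt_nonneg _)

theorem localNormSq_roundGrad_le [NeZero dv] [NeZero dμ] (hCv : 0 < Cv) (hγ0 : 0 ≤ γ) (hγ1 : γ < 1)
    (z : paramSet dv dμ Cv × Round S A dμ) :
    localNormSq z.1 (roundGrad M B γ z) ≤
      2 * Cv ^ 2 / (1 - γ) ^ 2 + dμ * gradBound Cv γ * scaledSq M B γ z := by
  have hdv : (dv : ℝ) ≠ 0 := NeZero.ne _
  have hdμ : (dμ : ℝ) ≠ 0 := NeZero.ne _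
  rw [localNormSq, scaledSq, mul_div_cancel₀ _ (mul_ne_zero hdμ (gradBound_pos hCv hγ1).ne')]
  gcongr
  calc Cv ^ 2 / (2 * dv) * ∑ i, (roundGrad M B γ z).1 i ^ 2
      ≤ Cv ^ 2 / (2 * dv) * ∑ _i : Fin dv, (2 / (1 - γ)) ^ 2 := by
        refine mul_le_mul_of_nonneg_left (Finset.sum_le_sum fun i _ => ?_) (by positivity)
        rw [← sq_abs]
        exact pow_le_pow_left₀ (abs_nonneg _) (abs_roundGrad_fst_le M B hγ0 hγ1 z i) 2
    _ = 2 * Cv ^ 2 / (1 - γ) ^ 2 := by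
        rw [Finset.sum_const, Finset.card_univ, Fintype.card_fin, nsmul_eq_mul]
        field_simp

variable [Fintype S] [Fintype A]

namespace IsTypical

variable {M B} {R : ℝ} {L : List (paramSet dv dμ Cv × Round S A dμ)}

theorem sum_scaledSq_le [NeZero dv] [NeZero dμ] (typical : IsTypical M B γ R L) (hCv : 0 < Cv)
    (hγ0 : 0 ≤ γ) (hγ1 : γ < 1) :
    (L.map (scaledSq M B γ)).sum ≤ R + L.length * gradBound Cv γ := by
  have deviation_le := typical.scaledSq_le
  have sum_expect_le : (L.map fun z => expect (roundLaw M B z.1) fun ω =>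
      scaledSq M B γ (z.1, ω)).sum ≤ L.length * gradBound Cv γ := by
    have := List.sum_le_card_nsmul (L.map fun z => expect (roundLaw M B z.1) fun ω =>
      scaledSq M B γ (z.1, ω)) (gradBound Cv γ) fun x hx => by
        obtain ⟨z, -, rfl⟩ := List.mem_map.1 hx
        exact expect_scaledSq_le M B hCv hγ0 hγ1 z.1
    rwa [List.length_map, nsmul_eq_mul] at this
  rw [deviation_eq_sub] at deviation_le
  linarith

theorem sum_localNormSq_le [NeZero dv] [NeZero dμ] (typical : IsTypical M B γ R L) (hCv : 0 < Cv)
    (hγ0 : 0 ≤ γ) (hγ1 : γ < 1) {N : ℝ} (hLN : L.length ≤ N) (hR : R ≤ 4 * gradBound Cv γ * N) :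
    (L.map fun z => localNormSq z.1 (roundGrad M B γ z)).sum ≤
      N * (2 * Cv ^ 2 / (1 - γ) ^ 2 + 5 * dμ * gradBound Cv γ ^ 2) := by
  have bound_pos := gradBound_pos hCv hγ1
  calc _ ≤ (L.map fun z => 2 * Cv ^ 2 / (1 - γ) ^ 2 +
          dμ * gradBound Cv γ * scaledSq M B γ z).sum :=
        List.sum_le_sum fun z _ => localNormSq_roundGrad_le M B hCv hγ0 hγ1 z
    _ = L.length * (2 * Cv ^ 2 / (1 - γ) ^ 2) +
          dμ * gradBound Cv γ * (L.map (scaledSq M B γ)).sum := by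
        rw [List.sum_map_add, List.sum_map_mul_left]
        simp
    _ ≤ N * (2 * Cv ^ 2 / (1 - γ) ^ 2) +
          dμ * gradBound Cv γ * (4 * gradBound Cv γ * N + N * gradBound Cv γ) := by
        have sum_le := typical.sum_scaledSq_le hCv hγ0 hγ1
        gcongr
        exact sum_le.trans (by gcongr)
    _ = N * (2 * Cv ^ 2 / (1 - γ) ^ 2 + 5 * dμ * gradBound Cv γ ^ 2) := by ring

theorem deviation_pairing_le [NeZero dv] [NeZero dμ] (typical : IsTypical M B γ R L)
    (ϑ : paramSet dv dμ Cv) :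
    deviation (roundLaw M B) L (fun z => pairing (roundGrad M B γ z) ϑ) ≤ (1 + Cv) * R := by
  have pairing_eq : (fun z : paramSet dv dμ Cv × Round S A dμ => pairing (roundGrad M B γ z) ϑ) =
      (∑ i, ϑ.1.1 i • fun z => (roundGrad M B γ z).1 i) +
        ∑ k, ϑ.1.2 k • fun z => (roundGrad M B γ z).2 k := by
    funext z
    simp [pairing, mul_comm]
  have fst_le := (le_abs_self _).trans (abs_sum_mul_le ϑ.2.1 typical.abs_fst_le)
  have snd_le : ∑ k, ϑ.1.2 k * deviation (roundLaw M B) L (fun z => (roundGrad M B γ z).2 k) ≤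
      R := by
    calc _ ≤ ∑ k, ϑ.1.2 k * R :=
          Finset.sum_le_sum fun k _ => mul_le_mul_of_nonneg_left (typical.snd_le k) (ϑ.2.2.1 k)
      _ = R := by rw [← Finset.sum_mul, ϑ.2.2.2, one_mul]
  simp only [pairing_eq, map_add, map_sum, map_smul, smul_eq_mul, mul_comm (ϑ.1.1 _)]
  linarith

theorem sum_residual_le [NeZero dv] [NeZero dμ] (typical : IsTypical M B γ R L)
    (ϑ : paramSet dv dμ Cv) :
    (L.map fun z => M.residual γ (B.decode z.1) (B.decode ϑ)).sum ≤
      (L.map fun z => pairing (roundGrad M B γ z) z.1 - pairing (roundGrad M B γ z) ϑ).sum +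
        (2 + Cv) * R := by
  have deviation_le : deviation (roundLaw M B) L
      ((fun z => -pairing (roundGrad M B γ z) z.1) + fun z => pairing (roundGrad M B γ z) ϑ) ≤
      R + (1 + Cv) * R := by
    rw [map_add]
    exact add_le_add typical.neg_pairing_le (typical.deviation_pairing_le ϑ)
  have neg_gap_eq :
      ((fun z : paramSet dv dμ Cv × Round S A dμ => -pairing (roundGrad M B γ z) z.1) +
        fun z => pairing (roundGrad M B γ z) ϑ) =
      -fun z => pairing (roundGrad M B γ z) z.1 - pairing (roundGrad M B γ z) ϑ := by
    funext z
    simp [neg_add_eq_sub]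
  rw [neg_gap_eq, map_neg, deviation_eq_sub] at deviation_le
  simp only [expect_pairing_sub] at deviation_le
  linarith

end IsTypical

/-- A typical run has small regret against every comparator at once, because each comparator enters
linearly, and so through the finitely many entries of the gradients only. -/
theorem mul_residual_average_le [NeZero dv] [NeZero dμ] (hCv : 0 < Cv) (hγ0 : 0 ≤ γ) (hγ1 : γ < 1)
    {θ : paramSet dv dμ Cv} (hθ : ∀ k, θ.1.2 k = 1 / dμ) {N : ℕ} {R : ℝ}
    (hN : (2 * (1 + Cv)) ^ 2 * dμ ≤ N) (hR : R ≤ 4 * gradBound Cv γ * N)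
    {l : List (Round S A dμ)} (hl : l.length + 1 = N)
    (typical : IsTypical M B γ R (steps (roundUpdate M B γ (stepSize γ Cv dμ N)) θ l))
    (ϑ : paramSet dv dμ Cv) :
    N * M.residual γ (B.average (iterates (roundUpdate M B γ (stepSize γ Cv dμ N)) θ l))
        (B.decode ϑ) ≤
      (4 + Real.log dμ + 5 * (2 * (1 + Cv)) ^ 2) / stepSize γ Cv dμ N + (2 + Cv) * R +
        2 * gradBound Cv γ := by
  have hdμ : (0 : ℝ) < dμ := Nat.cast_pos.2 (NeZero.pos dμ)
  have N_pos : 0 < N := hl ▸ Nat.succ_pos _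
  have η_pos : 0 < stepSize γ Cv dμ N := stepSize_pos hγ1 N_pos
  set η := stepSize γ Cv dμ N
  set L := steps (roundUpdate M B γ η) θ l with hL
  have length_le : (L.length : ℝ) ≤ N := by
    rw [hL, length_steps, ← hl]
    exact_mod_cast Nat.le_succ _
  have gap_le : (L.map fun z => pairing (roundGrad M B γ z) z.1 -
      pairing (roundGrad M B γ z) ϑ).sum ≤
      (4 + Real.log dμ + 5 * (2 * (1 + Cv)) ^ 2) / η := by
    have norms_le := (mul_le_mul_of_nonneg_left
      (typical.sum_localNormSq_le hCv hγ0 hγ1 length_le hR) (sq_nonneg η)).trans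
      (stepSize_sq_mul_sum_le hγ1 N_pos)
    rw [le_div_iff₀' η_pos]
    refine (mul_sum_pairing_sub_le η_pos (fun k => by rw [hθ]; positivity) hCv
      (roundGrad M B γ) (abs_stepSize_mul_roundGrad_snd_le_one M B hCv hγ0 hγ1 hN) ϑ l).trans ?_
    exact (add_le_add (bregman_le_of_uniform hCv hθ) norms_le).trans_eq (by ring)
  have average_eq := length_mul_residual_average (γ := γ) M B (B.decode ϑ)
    (List.ne_nil_of_length_eq_add_one (length_iterates (roundUpdate M B γ η) θ l))
  rw [length_iterates, hl] at average_eq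
  rw [average_eq, iterates_eq, List.map_append, List.sum_append, List.map_map]
  refine add_le_add ((typical.sum_residual_le ϑ).trans (add_le_add_left gap_le _)) ?_
  simpa using residual_decode_le M B (lastState (roundUpdate M B γ η) θ l) ϑ hγ0 hγ1

theorem residual_average_le [NeZero dv] (hγ0 : 0 ≤ γ) (hγ1 : γ < 1) {l : List (paramSet dv dμ Cv)}
    (hl : l ≠ []) (ϑ : paramSet dv dμ Cv) :
    M.residual γ (B.average l) (B.decode ϑ) ≤ 2 * gradBound Cv γ := by
  have length_pos : (0 : ℝ) < l.length := Nat.cast_pos.2 (List.length_pos_iff.2 hl)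
  refine le_of_mul_le_mul_left ?_ length_pos
  rw [length_mul_residual_average M B _ hl]
  have := List.sum_le_card_nsmul (l.map fun θ => M.residual γ (B.decode θ) (B.decode ϑ))
    (2 * gradBound Cv γ) fun x hx => by
      obtain ⟨θ, -, rfl⟩ := List.mem_map.1 hx
      exact residual_decode_le M B θ ϑ hγ0 hγ1
  rwa [List.length_map, nsmul_eq_mul] at this

end Regret

/-! ### The number of rounds -/

section RoundCount

/-- The factor `dim(Θ) log(1/δ)` of the sample complexity, up to a power of `log dim(Θ)`; the
dimension of `Θ` is `D`. -/
def complexity (D δ : ℝ) : ℝ := 2 * D * (1 + Real.log D) ^ 2 * Real.log (2 / δ)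

/-- A number of rounds (real, not rounded) after which the output has residual at most `ε` with
probability at least `1 - δ`. -/
def roundCount (Cv γ ε δ D : ℝ) : ℝ :=
  81 * (2 * (1 + Cv)) ^ 6 * complexity D δ / ((1 - γ) ^ 2 * ε ^ 2)

variable {D δ : ℝ}

theorem log_two_le_log_two_div (hδ : 0 < δ) (hδ1 : δ ≤ 1) : Real.log 2 ≤ Real.log (2 / δ) :=
  Real.log_le_log two_pos (le_div_self zero_le_two hδ hδ1)

theorem one_le_two_mul_log_two_div (hδ : 0 < δ) (hδ1 : δ ≤ 1) : 1 ≤ 2 * Real.log (2 / δ) := by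
  linarith [Real.log_two_gt_d9, log_two_le_log_two_div hδ hδ1]

theorem mul_one_add_log_sq_le_complexity (hD : 1 ≤ D) (hδ : 0 < δ) (hδ1 : δ ≤ 1) :
    D * (1 + Real.log D) ^ 2 ≤ complexity D δ := by
  calc D * (1 + Real.log D) ^ 2
      ≤ D * (1 + Real.log D) ^ 2 * (2 * Real.log (2 / δ)) :=
        le_mul_of_one_le_right (by positivity) (one_le_two_mul_log_two_div hδ hδ1)
    _ = complexity D δ := by
        rw [complexity]
        ring

theorem le_complexity (hD : 1 ≤ D) (hδ : 0 < δ) (hδ1 : δ ≤ 1) : D ≤ complexity D δ :=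
  (le_mul_of_one_le_right (by positivity)
    (one_le_pow₀ (le_add_of_nonneg_right (Real.log_nonneg hD)))).trans
    (mul_one_add_log_sq_le_complexity hD hδ hδ1)

theorem log_four_mul_div_le (hD : 1 ≤ D) (hδ : 0 < δ) (hδ1 : δ ≤ 1) :
    Real.log (4 * D / δ) ≤ 2 * (1 + Real.log D) * Real.log (2 / δ) := by
  have log_eq : Real.log (4 * D / δ) = Real.log 2 + Real.log D + Real.log (2 / δ) := by
    rw [← Real.log_mul (by norm_num) (by positivity),
      ← Real.log_mul (by positivity) (by positivity)]
    congr 1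
    ring
  have log_D_le : Real.log D * 1 ≤ Real.log D * (2 * Real.log (2 / δ)) :=
    mul_le_mul_of_nonneg_left (one_le_two_mul_log_two_div hδ hδ1) (Real.log_nonneg hD)
  linarith [log_two_le_log_two_div hδ hδ1]

theorem mul_log_four_mul_div_le_complexity (hD : 1 ≤ D) (hδ : 0 < δ) (hδ1 : δ ≤ 1) :
    D * Real.log (4 * D / δ) ≤ complexity D δ := by
  have log_nonneg : 0 ≤ Real.log (2 / δ) := by linarith [one_le_two_mul_log_two_div hδ hδ1]
  have one_le : 1 ≤ 1 + Real.log D := le_add_of_nonneg_right (Real.log_nonneg hD)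
  calc D * Real.log (4 * D / δ) ≤ D * (2 * (1 + Real.log D) * Real.log (2 / δ)) := by
        gcongr
        exact log_four_mul_div_le hD hδ hδ1
    _ ≤ D * (2 * (1 + Real.log D) ^ 2 * Real.log (2 / δ)) := by
        gcongr
        exact le_self_pow₀ one_le two_ne_zero
    _ = complexity D δ := by
        rw [complexity]
        ring

variable {Cv γ ε N d : ℝ}

theorem roundCount_nonneg (hCv : 0 < Cv) (hD : 1 ≤ D) (hδ : 0 < δ) (hδ1 : δ ≤ 1) :
    0 ≤ roundCount Cv γ ε δ D := by
  have complexity_nonneg : 0 ≤ complexity D δ := by linarith [le_complexity hD hδ hδ1]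
  rw [roundCount]
  positivity

theorem mul_sqrt_mul_complexity_le (hγ1 : γ < 1) (hε : 0 < ε) (hCv : 0 < Cv) (hD : 1 ≤ D)
    (hδ : 0 < δ) (hδ1 : δ ≤ 1) (hN : roundCount Cv γ ε δ D ≤ N) :
    9 * (2 * (1 + Cv)) ^ 3 * Real.sqrt (N * complexity D δ) ≤ N * ((1 - γ) * ε) := by
  have hpos : 0 < 1 - γ := sub_pos.2 hγ1
  have N_nonneg : 0 ≤ N := (roundCount_nonneg hCv hD hδ hδ1).trans hN
  have complexity_nonneg : 0 ≤ complexity D δ := by linarith [le_complexity hD hδ hδ1]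
  rw [roundCount, div_le_iff₀ (by positivity)] at hN
  refine le_of_sq_le_sq ?_ (by positivity)
  rw [mul_pow, Real.sq_sqrt (by positivity)]
  calc _ = N * (81 * (2 * (1 + Cv)) ^ 6 * complexity D δ) := by ring
    _ ≤ N * (N * ((1 - γ) ^ 2 * ε ^ 2)) := by gcongr
    _ = (N * ((1 - γ) * ε)) ^ 2 := by ring

theorem sq_mul_complexity_le (hγ1 : γ < 1) (hε : 0 < ε) (hCv : 0 < Cv) (hD : 1 ≤ D)
    (hδ : 0 < δ) (hδ1 : δ ≤ 1) (hsmall : (1 - γ) * ε ≤ 2 * (2 * (1 + Cv)))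
    (hN : roundCount Cv γ ε δ D ≤ N) : (2 * (1 + Cv)) ^ 2 * complexity D δ ≤ N := by
  have complexity_nonneg : 0 ≤ complexity D δ := by linarith [le_complexity hD hδ hδ1]
  have one_le : 1 ≤ 2 * (1 + Cv) := by linarith
  refine le_trans ?_ hN
  rw [roundCount, le_div_iff₀ (by positivity), ← mul_pow]
  calc (2 * (1 + Cv)) ^ 2 * complexity D δ * ((1 - γ) * ε) ^ 2
      ≤ (2 * (1 + Cv)) ^ 2 * complexity D δ * (2 * (2 * (1 + Cv))) ^ 2 := by gcongr
    _ = 4 * (2 * (1 + Cv)) ^ 4 * complexity D δ := by ring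
    _ ≤ 81 * (2 * (1 + Cv)) ^ 6 * complexity D δ := by
        gcongr <;> norm_num

theorem mul_log_four_mul_div_le_of_roundCount_le (hγ1 : γ < 1) (hε : 0 < ε) (hCv : 0 < Cv)
    (hdD : d ≤ D) (hD : 1 ≤ D) (hδ : 0 < δ) (hδ1 : δ ≤ 1)
    (hsmall : (1 - γ) * ε ≤ 2 * (2 * (1 + Cv))) (hN : roundCount Cv γ ε δ D ≤ N) :
    d * Real.log (4 * D / δ) ≤ N := by
  have log_nonneg : 0 ≤ Real.log (4 * D / δ) :=
    Real.log_nonneg ((one_le_div hδ).2 (by linarith))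
  calc d * Real.log (4 * D / δ) ≤ D * Real.log (4 * D / δ) := by gcongr
    _ ≤ complexity D δ := mul_log_four_mul_div_le_complexity hD hδ hδ1
    _ ≤ (2 * (1 + Cv)) ^ 2 * complexity D δ :=
        le_mul_of_one_le_left (by linarith [le_complexity hD hδ hδ1])
          (one_le_pow₀ (by linarith))
    _ ≤ N := sq_mul_complexity_le hγ1 hε hCv hD hδ hδ1 hsmall hN

theorem sqrt_mul_one_add_log_le (hCv : 0 < Cv) (hdD : d ≤ D) (hD : 1 ≤ D) (hN : 0 ≤ N)
    (hδ : 0 < δ) (hδ1 : δ ≤ 1) :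
    Real.sqrt (N * (Cv ^ 2 + d)) * (1 + Real.log D) ≤
      2 * (1 + Cv) * Real.sqrt (N * complexity D δ) := by
  have log_nonneg := Real.log_nonneg hD
  have sq_add_le : Cv ^ 2 + d ≤ (2 * (1 + Cv)) ^ 2 * D := by
    nlinarith [mul_nonneg (sq_nonneg (2 * (1 + Cv))) (sub_nonneg.2 hD)]
  rw [← Real.sqrt_sq (by positivity : 0 ≤ 1 + Real.log D), ← Real.sqrt_mul' _ (sq_nonneg _),
    ← Real.sqrt_sq (by positivity : 0 ≤ 2 * (1 + Cv)), ← Real.sqrt_mul (sq_nonneg _)]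
  refine Real.sqrt_le_sqrt ?_
  calc N * (Cv ^ 2 + d) * (1 + Real.log D) ^ 2
      ≤ N * ((2 * (1 + Cv)) ^ 2 * D) * (1 + Real.log D) ^ 2 := by gcongr
    _ = (2 * (1 + Cv)) ^ 2 * (N * (D * (1 + Real.log D) ^ 2)) := by ring
    _ ≤ (2 * (1 + Cv)) ^ 2 * (N * complexity D δ) := by
        gcongr
        exact mul_one_add_log_sq_le_complexity hD hδ hδ1

theorem sqrt_mul_log_four_mul_div_le (hdD : d ≤ D) (hD : 1 ≤ D) (hN : 0 ≤ N) (hδ : 0 < δ)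
    (hδ1 : δ ≤ 1) :
    Real.sqrt (N * d * Real.log (4 * D / δ)) ≤ Real.sqrt (N * complexity D δ) := by
  have log_nonneg : 0 ≤ Real.log (4 * D / δ) :=
    Real.log_nonneg ((one_le_div hδ).2 (by linarith))
  rw [mul_assoc]
  gcongr
  exact (mul_le_mul_of_nonneg_right hdD log_nonneg).trans
    (mul_log_four_mul_div_le_complexity hD hδ hδ1)

theorem sqrt_mul_add_log_le (hCv : 0 < Cv) (hd : 1 ≤ d) (hdD : d ≤ D) (hN : 0 ≤ N)
    (hδ : 0 < δ) (hδ1 : δ ≤ 1) :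
    Real.sqrt (N * (Cv ^ 2 + d)) * (4 + Real.log d + 5 * (2 * (1 + Cv)) ^ 2) ≤
      (4 + 5 * (2 * (1 + Cv)) ^ 2) * (2 * (1 + Cv) * Real.sqrt (N * complexity D δ)) := by
  have log_le : Real.log d ≤ Real.log D := Real.log_le_log (zero_lt_one.trans_le hd) hdD
  have log_nonneg : 0 ≤ Real.log D := Real.log_nonneg (hd.trans hdD)
  have add_log_le : 4 + Real.log d + 5 * (2 * (1 + Cv)) ^ 2 ≤
      (4 + 5 * (2 * (1 + Cv)) ^ 2) * (1 + Real.log D) := by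
    linarith [show 0 ≤ (3 + 5 * (2 * (1 + Cv)) ^ 2) * Real.log D by positivity]
  calc _ ≤ Real.sqrt (N * (Cv ^ 2 + d)) *
        ((4 + 5 * (2 * (1 + Cv)) ^ 2) * (1 + Real.log D)) := by gcongr
    _ = (4 + 5 * (2 * (1 + Cv)) ^ 2) *
        (Real.sqrt (N * (Cv ^ 2 + d)) * (1 + Real.log D)) := by ring
    _ ≤ _ := mul_le_mul_of_nonneg_left
        (sqrt_mul_one_add_log_le hCv hdD (hd.trans hdD) hN hδ hδ1) (by positivity)

theorem regret_bound_le (hγ1 : γ < 1) (hCv : 0 < Cv) (hd : 1 ≤ d) (hdD : d ≤ D) (hN : 1 ≤ N)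
    (hδ : 0 < δ) (hδ1 : δ ≤ 1) :
    (4 + Real.log d + 5 * (2 * (1 + Cv)) ^ 2) / ((1 - γ) / Real.sqrt (N * (Cv ^ 2 + d))) +
        (2 + Cv) * (4 * gradBound Cv γ * Real.sqrt (N * d * Real.log (4 * D / δ))) +
        2 * gradBound Cv γ ≤
      9 * (2 * (1 + Cv)) ^ 3 * Real.sqrt (N * complexity D δ) / (1 - γ) := by
  have hpos : 0 < 1 - γ := sub_pos.2 hγ1
  have hD : 1 ≤ D := hd.trans hdD
  have N_nonneg : 0 ≤ N := zero_le_one.trans hN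
  have one_le_sqrt : 1 ≤ Real.sqrt (N * complexity D δ) :=
    Real.one_le_sqrt.2 (one_le_mul_of_one_le_of_one_le hN (hD.trans (le_complexity hD hδ hδ1)))
  have const_le : (4 + 5 * (2 * (1 + Cv)) ^ 2) * (2 * (1 + Cv)) +
      (2 + Cv) * (4 * (2 * (1 + Cv))) + 2 * (2 * (1 + Cv)) ≤ 9 * (2 * (1 + Cv)) ^ 3 := by
    nlinarith [pow_pos hCv 2, pow_pos hCv 3]
  have first_le := sqrt_mul_add_log_le hCv hd hdD N_nonneg hδ hδ1
  have noise_le := sqrt_mul_log_four_mul_div_le hdD hD N_nonneg hδ hδ1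
  set T := Real.sqrt (N * complexity D δ)
  rw [gradBound, le_div_iff₀ hpos]
  calc _ = Real.sqrt (N * (Cv ^ 2 + d)) * (4 + Real.log d + 5 * (2 * (1 + Cv)) ^ 2) +
        (2 + Cv) * (4 * (2 * (1 + Cv))) * Real.sqrt (N * d * Real.log (4 * D / δ)) +
        2 * (2 * (1 + Cv)) * 1 := by field_simp
    _ ≤ (4 + 5 * (2 * (1 + Cv)) ^ 2) * (2 * (1 + Cv) * T) + (2 + Cv) * (4 * (2 * (1 + Cv))) * T +
        2 * (2 * (1 + Cv)) * T := by gcongr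
    _ = ((4 + 5 * (2 * (1 + Cv)) ^ 2) * (2 * (1 + Cv)) + (2 + Cv) * (4 * (2 * (1 + Cv))) +
        2 * (2 * (1 + Cv))) * T := by ring
    _ ≤ 9 * (2 * (1 + Cv)) ^ 3 * T := by gcongr

end RoundCount

/-! ### The probabilistic guarantee -/

section Guarantee

theorem ofReal_one_sub_le_toOuterMeasure {α : Type*} (p : PMF α) {typical good : Set α} {δ : ℝ}
    (hδ : 0 ≤ δ) (not_typical_le : p.toOuterMeasure {a | a ∉ typical} ≤ ENNReal.ofReal δ)
    (good_of_typical : ∀ a ∈ p.support, a ∈ typical → a ∈ good) :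
    ENNReal.ofReal (1 - δ) ≤ p.toOuterMeasure good := by
  have cover : p.toOuterMeasure (good ∪ {a | a ∉ typical}) = 1 := by
    rw [PMF.toOuterMeasure_apply_eq_one_iff]
    intro a ha
    by_cases mem : a ∈ typical
    · exact Or.inl (good_of_typical a ha mem)
    · exact Or.inr mem
  rw [ENNReal.ofReal_sub _ hδ, ENNReal.ofReal_one, tsub_le_iff_right, ← cover]
  exact (MeasureTheory.measure_union_le _ _).trans (by gcongr)

variable {S : Type u} {A : Type v} {dv dμ : ℕ} {Cv γ : ℝ} (M : MDP S A) (B : Basis S A dv dμ)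

theorem snd_eq_of_mem_support_run_mdForRL [NeZero dμ] {N : ℕ} {θ : paramSet dv dμ Cv}
    {o : Decision S A × ℕ} (ho : o ∈ ((mdForRL γ B N θ).run M).support) : o.2 = 3 * (N - 1) := by
  rw [run_mdForRL, PMF.mem_support_map_iff] at ho
  obtain ⟨l, -, rfl⟩ := ho
  rfl

variable [Fintype S] [Fintype A]

theorem ret_sub_ret_le [Nonempty (paramSet dv dμ Cv)] (hγ0 : 0 ≤ γ) (hγ1 : γ < 1)
    {x : Decision S A} {ε : ℝ}
    (hx : ∀ ϑ : paramSet dv dμ Cv, M.residual γ x (B.decode ϑ) ≤ ε) (π : Policy S A)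
    {πhat : Policy S A} (hπhat : IsInducedBy πhat x.2) :
    M.ret γ π - M.ret γ πhat ≤ ε + approxError M γ B Cv π πhat x := by
  rw [← sub_le_iff_le_add']
  refine le_ciInf fun ϑ => ?_
  rw [M.residual_value_occupancy π hγ0 hγ1 hπhat]
  linarith [hx ϑ]

theorem residual_average_le_of_isTypical [NeZero dv] [NeZero dμ] (hCv : 0 < Cv) (hγ0 : 0 ≤ γ)
    (hγ1 : γ < 1) {ε δ : ℝ} (hε : 0 < ε) (hδ : 0 < δ) (hδ1 : δ ≤ 1)
    (hsmall : (1 - γ) * ε ≤ 2 * (2 * (1 + Cv))) {θ : paramSet dv dμ Cv}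
    (hθ : ∀ k, θ.1.2 k = 1 / dμ) {N : ℕ} (hN : roundCount Cv γ ε δ (dv + dμ) ≤ N)
    {l : List (Round S A dμ)} (hl : l.length + 1 = N)
    (typical : IsTypical M B γ
      (4 * gradBound Cv γ * Real.sqrt (N * dμ * Real.log (4 * (dv + dμ) / δ)))
      (steps (roundUpdate M B γ (stepSize γ Cv dμ N)) θ l)) (ϑ : paramSet dv dμ Cv) :
    M.residual γ (B.average (iterates (roundUpdate M B γ (stepSize γ Cv dμ N)) θ l))
      (B.decode ϑ) ≤ ε := by
  have one_le_dv : (1 : ℝ) ≤ dv := Nat.one_le_cast.2 (NeZero.pos dv)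
  have one_le_dμ : (1 : ℝ) ≤ dμ := Nat.one_le_cast.2 (NeZero.pos dμ)
  have dμ_le : (dμ : ℝ) ≤ dv + dμ := by linarith
  have one_le : (1 : ℝ) ≤ dv + dμ := by linarith
  have one_le_N : (1 : ℝ) ≤ N := Nat.one_le_cast.2 (hl ▸ Nat.succ_pos _)
  have bound_pos := gradBound_pos hCv hγ1
  have sq_mul_le : (2 * (1 + Cv)) ^ 2 * dμ ≤ N := by
    refine le_trans ?_ (sq_mul_complexity_le hγ1 hε hCv one_le hδ hδ1 hsmall hN)
    gcongr
    exact dμ_le.trans (le_complexity one_le hδ hδ1)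
  have sqrt_le : Real.sqrt (N * dμ * Real.log (4 * (dv + dμ) / δ)) ≤ N := by
    rw [Real.sqrt_le_left (by positivity), mul_assoc, sq]
    gcongr
    exact mul_log_four_mul_div_le_of_roundCount_le hγ1 hε hCv dμ_le one_le hδ hδ1 hsmall hN
  refine le_of_mul_le_mul_left ?_ (zero_lt_one.trans_le one_le_N)
  refine (mul_residual_average_le M B hCv hγ0 hγ1 hθ sq_mul_le (by gcongr) hl typical ϑ).trans ?_
  refine (regret_bound_le hγ1 hCv one_le_dμ dμ_le one_le_N hδ hδ1).trans ?_
  rw [div_le_iff₀ (sub_pos.2 hγ1)]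
  linarith [mul_sqrt_mul_complexity_le hγ1 hε hCv one_le hδ hδ1 hN]

/-- The output has small residual against all of `Θ` simultaneously, so that the comparator may be
chosen after the run, as the approximation error requires. -/
theorem ofReal_one_sub_le_residual_le [NeZero dv] [NeZero dμ] (hCv : 0 < Cv) (hγ0 : 0 ≤ γ)
    (hγ1 : γ < 1) {ε δ : ℝ} (hε : 0 < ε) (hδ : 0 < δ) (hδ1 : δ ≤ 1) {θ : paramSet dv dμ Cv}
    (hθ : ∀ k, θ.1.2 k = 1 / dμ) {N : ℕ} (hN_pos : 0 < N)
    (hN : roundCount Cv γ ε δ (dv + dμ) ≤ N) :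
    ENNReal.ofReal (1 - δ) ≤ ((mdForRL γ B N θ).run M).toOuterMeasure
      {o | ∀ ϑ : paramSet dv dμ Cv, M.residual γ o.1 (B.decode ϑ) ≤ ε} := by
  rw [run_mdForRL, PMF.toOuterMeasure_map_apply]
  rcases le_total ((1 - γ) * ε) (2 * (2 * (1 + Cv))) with hsmall | hlarge
  · have one_le_dv : (1 : ℝ) ≤ dv := Nat.one_le_cast.2 (NeZero.pos dv)
    have dμ_le : (dμ : ℝ) ≤ dv + dμ := by linarith
    have one_le : (1 : ℝ) ≤ dv + dμ := by linarith [(Nat.cast_nonneg dμ : (0 : ℝ) ≤ dμ)]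
    have exp_neg_log : 4 * (dv + dμ) * Real.exp (-Real.log (4 * (dv + dμ) / δ)) = δ := by
      rw [← Real.log_inv, Real.exp_log (by positivity)]
      field_simp
    have not_typical_le := drawsLaw_not_isTypical_le M B hCv hγ0 hγ1
      (roundUpdate M B γ (stepSize γ Cv dμ N))
      (Real.log_nonneg ((one_le_div hδ).2 (by linarith : δ ≤ 4 * (dv + dμ))))
      (Nat.cast_pos.2 hN_pos)
      (mul_log_four_mul_div_le_of_roundCount_le hγ1 hε hCv dμ_le one_le hδ hδ1 hsmall hN)
      (Nat.cast_le.2 (Nat.sub_le N 1)) θ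
    rw [exp_neg_log] at not_typical_le
    refine ofReal_one_sub_le_toOuterMeasure _ hδ.le not_typical_le fun l hl typical ϑ => ?_
    have length_eq : l.length + 1 = N := by
      rw [length_of_mem_support_drawsLaw _ _ hl, Nat.sub_add_cancel hN_pos]
    exact residual_average_le_of_isTypical M B hCv hγ0 hγ1 hε hδ hδ1 hsmall hθ hN length_eq
      typical ϑ
  · refine (ENNReal.ofReal_le_one.2 (by linarith)).trans_eq ?_
    rw [eq_comm, PMF.toOuterMeasure_apply_eq_one_iff]
    intro l _ ϑ
    refine (residual_average_le M B hγ0 hγ1 (List.ne_nil_of_length_eq_add_one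
      (length_iterates _ _ _)) ϑ).trans ?_
    rw [gradBound, ← mul_div_assoc, div_le_iff₀' (sub_pos.2 hγ1)]
    exact hlarge

end Guarantee

end MirrorRL

end

open MirrorRL in
theorem mainTheorem6_general (Cv : ℝ) (hCv : 0 < Cv) :
    ∃ C : ℝ, 0 < C ∧
      ∀ (dv dμ : ℕ) [NeZero dv] [NeZero dμ] (γ ε δ : ℝ),
        0 ≤ γ → γ < 1 → 0 < ε → 0 < δ → δ ≤ 1 →
        ∃ N₀ : ℕ, 0 < N₀ ∧
          ∀ (S : Type u) (A : Type v) [Fintype S] [Fintype A]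
            (B : Basis S A dv dμ) (θ₁ : paramSet dv dμ Cv),
            (∀ k, θ₁.1.2 k = 1 / dμ) →
            ∀ M : MDP S A,
              (∀ o ∈ ((mdForRL γ B N₀ θ₁).run M).support,
                (o.2 : ℝ) ≤ C * ((dv + dμ : ℕ) * (1 + Real.log (dv + dμ : ℕ)) ^ 2 *
                  Real.log (2 / δ) / ((1 - γ) ^ 2 * ε ^ 2))) ∧
              ∀ N : ℕ, N₀ ≤ N →
                ENNReal.ofReal (1 - δ) ≤
                  ((mdForRL γ B N θ₁).run M).toOuterMeasure
                    {o | ∀ π πhat : Policy S A, IsInducedBy πhat o.1.2 →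
                      M.ret γ π - M.ret γ πhat ≤ ε + approxError M γ B Cv π πhat o.1} := by
  refine ⟨486 * (2 * (1 + Cv)) ^ 6, by positivity, fun dv dμ _ _ γ ε δ hγ0 hγ1 hε hδ hδ1 => ?_⟩
  have hD : (1 : ℝ) ≤ dv + dμ := by exact_mod_cast (NeZero.pos dv).trans_le (Nat.le_add_right _ _)
  refine ⟨⌊roundCount Cv γ ε δ (dv + dμ)⌋₊ + 1, Nat.succ_pos _, fun S A _ _ B θ₁ hθ₁ M =>
    ⟨fun o ho => ?_, fun N hN => ?_⟩⟩
  · have floor_le := Nat.floor_le (roundCount_nonneg (γ := γ) (ε := ε) hCv hD hδ hδ1)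
    rw [snd_eq_of_mem_support_run_mdForRL M B ho, Nat.add_sub_cancel]
    push_cast
    calc _ ≤ 3 * roundCount Cv γ ε δ (dv + dμ) := by linarith
      _ = _ := by
        rw [roundCount, complexity]
        ring
  · have count_le : roundCount Cv γ ε δ (dv + dμ) ≤ N :=
      (Nat.lt_floor_add_one _).le.trans (by exact_mod_cast hN)
    have : Nonempty (paramSet dv dμ Cv) := ⟨θ₁⟩
    exact (ofReal_one_sub_le_residual_le M B hCv hγ0 hγ1 hε hδ hδ1 hθ₁
      ((Nat.succ_pos _).trans_le hN) count_le).trans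
      (MeasureTheory.measure_mono fun o ho π _ => ret_sub_ret_le M B hγ0 hγ1 ho π)

open MirrorRL in
theorem mainTheorem6 (Cv : ℝ) (hCv : 0 < Cv) :
    ∃ C : ℝ, 0 < C ∧
      ∀ (dv dμ : ℕ) [NeZero dv] [NeZero dμ] (γ ε δ : ℝ),
        0 ≤ γ → γ < 1 → 0 < ε → 0 < δ → δ < 1 →
        ∃ N₀ : ℕ, 0 < N₀ ∧
          ∀ (S : Type u) (A : Type v) [Fintype S] [Fintype A] [Nonempty S] [Nonempty A]
            (B : Basis S A dv dμ) (θ₁ : paramSet dv dμ Cv),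
            (∀ k, θ₁.1.2 k = 1 / dμ) →
            ∀ M : MDP S A,
              (∀ o ∈ ((mdForRL γ B N₀ θ₁).run M).support,
                (o.2 : ℝ) ≤ C * ((dv + dμ : ℕ) * (1 + Real.log (dv + dμ : ℕ)) ^ 2 *
                  Real.log (2 / δ) / ((1 - γ) ^ 2 * ε ^ 2))) ∧
              ∀ N : ℕ, N₀ ≤ N → ∀ πstar : Policy S A, M.IsOptimal γ πstar →
                ENNReal.ofReal (1 - δ) ≤
                  ((mdForRL γ B N θ₁).run M).toOuterMeasure
                    {o | ∀ πhat : Policy S A, IsInducedBy πhat o.1.2 →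
                      M.ret γ πstar - M.ret γ πhat ≤
                        ε + approxError M γ B Cv πstar πhat o.1} := by
  obtain ⟨C, C_pos, guarantee⟩ := mainTheorem6_general.{u, v} Cv hCv
  refine ⟨C, C_pos, fun dv dμ _ _ γ ε δ hγ0 hγ1 hε hδ hδ1 => ?_⟩
  obtain ⟨N₀, N₀_pos, hN₀⟩ := guarantee dv dμ γ ε δ hγ0 hγ1 hε hδ hδ1.le
  exact ⟨N₀, N₀_pos, fun S A _ _ _ _ B θ₁ hθ₁ M => ⟨(hN₀ S A B θ₁ hθ₁ M).1,
    fun N hN πstar _ => ((hN₀ S A B θ₁ hθ₁ M).2 N hN).trans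
      (MeasureTheory.measure_mono fun _ ho => ho πstar)⟩⟩
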